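/- Identify $\mathbb{R}^2$ with $\mathbb{C}$. For $n\in\mathbb{N}=\{1,2,3,\dots\}$ let $C_n\subseteq\mathbb{R}^2$ be the circle of radius $\frac1n$ centered at $(\frac1n,0)$, let $\mathbb{H}=\bigcup_{n\geqslant 1}C_n\subseteq\mathbb{R}^2$ be the Hawaiian earring (with the subspace topology), and let $\ell_n:[0,1]\to C_n$, $\ell_n(t)=\big(\frac1n(1-\cos 2\pi t),\frac1n\sin 2\pi t\big)$. For each $n\in\mathbb{N}$ let $P_n$ be a copy of the pair of pants $P=D\setminus(D_1^\circ\cup D_2^\circ)$, where $D$ is the closed disk of radius $4$ centered at $0$ and $D_1$, $D_2$ are the closed disks of radius $1$ centered at $2i$ and $-2i$, and let $\alpha_n,\beta_n,\gamma_n:[0,1]\to P_n$ be the clockwise parametrizations of $\partial D$, $\partial D_1$ and $\partial D_2$ given by $t\mapsto c-re^{-2\pi i t}$ ($c$ the center and $r$ the radius of the disk). Let $\mathbb{P}$ (the Hawaiian pants) be the space obtained from $\mathbb{H}$ by attaching all the $P_n$ along their boundaries via the maps $f_n:\partial P_n\to\mathbb{H}$ with $f_n\circ\alpha_n=\ell_n$,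 $f_n\circ\beta_n=\ell_{2n}$ and $f_n\circ\gamma_n=\ell_{2n+1}$; that is, $\mathbb{P}$ is the quotient space, with the quotient topology, of the disjoint union $\mathbb{H}\sqcup\coprod_{n\geqslant 1}P_n$ by the identifications $z\sim f_n(z)$ for $z\in\partial P_n$, $n\in\mathbb{N}$. A path-connected space $X$ is called strongly homotopically Hausdorff if for every point $x\in X$ and every essential loop $\gamma$ in $X$ (a loop that is not null-homotopic relative to its endpoints) there is an open neighborhood $U$ of $x$ in $X$ such that $\gamma$ is not freely homotopic in $X$ to any loop lying in $U$. **Theorem.** $\mathbb{P}$ is (path-connected and) strongly homotopically Hausdorff. -/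

import Mathlib

open scoped unitInterval

namespace HawaiianPants

noncomputable section

/-- The circle `C n` of radius `1 / n` centered at `(1 / n, 0)`; the plane is identified with `ℂ`. -/
def earringCircle (n : ℕ+) : Set ℂ := Metric.sphere (1 / (n : ℂ)) (1 / (n : ℝ))

/-- The Hawaiian earring, the union of the circles `C n` for `n = 1, 2, 3, …`. -/
def earring : Set ℂ := ⋃ n : ℕ+, earringCircle n

/-- The clockwise loop in the plane that runs once around the circle with center `c` and
radius `r`, starting and ending at its leftmost point `c - r`. -/
def clockwise (c : ℂ) (r : ℝ) (t : I) : ℂ :=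
  c - r * Complex.exp (-(2 * Real.pi * (t : ℝ) * Complex.I))

/-- The closed round disk of radius `4` about `0`, with two disjoint open round disks of radius `1`
removed, namely those centered at `2 i` and at `-2 i`. -/
def pants : Set ℂ :=
  Metric.closedBall 0 4 \ (Metric.ball (2 * Complex.I) 1 ∪ Metric.ball (-(2 * Complex.I)) 1)

theorem norm_clockwise_sub (c : ℂ) {r : ℝ} (hr : 0 ≤ r) (t : I) : ‖clockwise c r t - c‖ = r := by
  have h : Complex.exp (-(2 * Real.pi * (t : ℝ) * Complex.I))
      = Complex.exp ((-(2 * Real.pi * (t : ℝ)) : ℝ) * Complex.I) := by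
    congr 1; push_cast; ring
  rw [clockwise, sub_sub_cancel_left, norm_neg, norm_mul, h, Complex.norm_exp_ofReal_mul_I,
    mul_one, Complex.norm_real, Real.norm_of_nonneg hr]

theorem clockwise_mem_earring (n : ℕ+) (t : I) :
    clockwise (1 / (n : ℂ)) (1 / (n : ℝ)) t ∈ earring := by
  refine Set.mem_iUnion.2 ⟨n, ?_⟩
  rw [earringCircle, mem_sphere_iff_norm]
  exact norm_clockwise_sub _ (by positivity) t

theorem norm_four_I : ‖(4 : ℂ) * Complex.I‖ = 4 := by simp

theorem norm_two_I : ‖(2 : ℂ) * Complex.I‖ = 2 := by simp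

theorem outer_mem_pants (t : I) : clockwise 0 4 t ∈ pants := by
  have h := norm_clockwise_sub 0 (r := 4) (by norm_num) t
  have h2 := norm_two_I
  rw [sub_zero] at h
  simp only [pants, Set.mem_sdiff, Set.mem_union, mem_closedBall_iff_norm, mem_ball_iff_norm,
    sub_zero, sub_neg_eq_add, not_or, not_lt]
  refine ⟨h.le, ?_, ?_⟩
  · have := norm_sub_norm_le (clockwise 0 4 t) (2 * Complex.I)
    linarith
  · have := norm_sub_norm_le (clockwise 0 4 t) (-(2 * Complex.I))
    rw [norm_neg, sub_neg_eq_add] at this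
    linarith

theorem inner₁_mem_pants (t : I) : clockwise (2 * Complex.I) 1 t ∈ pants := by
  set z := clockwise (2 * Complex.I) 1 t
  have h : ‖z - 2 * Complex.I‖ = 1 := norm_clockwise_sub _ (r := 1) (by norm_num) t
  have h2 := norm_two_I
  simp only [pants, Set.mem_sdiff, Set.mem_union, mem_closedBall_iff_norm, mem_ball_iff_norm,
    sub_zero, sub_neg_eq_add, not_or, not_lt]
  refine ⟨?_, h.ge, ?_⟩
  · have := norm_sub_norm_le z (2 * Complex.I)
    linarith
  · have := norm_sub_le (z + 2 * Complex.I) (z - 2 * Complex.I)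
    rw [show z + 2 * Complex.I - (z - 2 * Complex.I) = 4 * Complex.I by ring, norm_four_I] at this
    linarith

theorem inner₂_mem_pants (t : I) : clockwise (-(2 * Complex.I)) 1 t ∈ pants := by
  set z := clockwise (-(2 * Complex.I)) 1 t
  have h : ‖z - -(2 * Complex.I)‖ = 1 := norm_clockwise_sub _ (r := 1) (by norm_num) t
  have h2 := norm_two_I
  rw [sub_neg_eq_add] at h
  simp only [pants, Set.mem_sdiff, Set.mem_union, mem_closedBall_iff_norm, mem_ball_iff_norm,
    sub_zero, sub_neg_eq_add, not_or, not_lt]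
  refine ⟨?_, ?_, h.ge⟩
  · have := norm_sub_norm_le z (-(2 * Complex.I))
    rw [norm_neg, sub_neg_eq_add] at this
    linarith
  · have := norm_sub_le (z + 2 * Complex.I) (z - 2 * Complex.I)
    rw [show z + 2 * Complex.I - (z - 2 * Complex.I) = 4 * Complex.I by ring, norm_four_I] at this
    linarith

/-- The loop `ℓ n` in the Hawaiian earring,
`ℓ n (t) = ((1 - cos 2πt) / n, (sin 2πt) / n)`. -/
def earringLoop (n : ℕ+) (t : I) : earring :=
  ⟨clockwise (1 / (n : ℂ)) (1 / (n : ℝ)) t, clockwise_mem_earring n t⟩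

/-- The clockwise parametrization of the outer boundary circle of the pair of pants. -/
def outerLoop (t : I) : pants := ⟨clockwise 0 4 t, outer_mem_pants t⟩

/-- The clockwise parametrization of the boundary circle of the first removed disk. -/
def innerLoop₁ (t : I) : pants := ⟨clockwise (2 * Complex.I) 1 t, inner₁_mem_pants t⟩

/-- The clockwise parametrization of the boundary circle of the second removed disk. -/
def innerLoop₂ (t : I) : pants := ⟨clockwise (-(2 * Complex.I)) 1 t, inner₂_mem_pants t⟩

/-- The identifications made when the `n`-th copy of the pair of pants is attached to the Hawaiian
earring, for all `n = 1, 2, 3, …`: the outer boundary is attached along `ℓ n`, and the two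
inner boundaries along `ℓ (2n)` and `ℓ (2n + 1)`. -/
inductive Attach : earring ⊕ (Σ _ : ℕ+, pants) → earring ⊕ (Σ _ : ℕ+, pants) → Prop
  | outer (n : ℕ+) (t : I) : Attach (Sum.inr ⟨n, outerLoop t⟩) (Sum.inl (earringLoop n t))
  | inner₁ (n : ℕ+) (t : I) :
      Attach (Sum.inr ⟨n, innerLoop₁ t⟩) (Sum.inl (earringLoop (2 * n) t))
  | inner₂ (n : ℕ+) (t : I) :
      Attach (Sum.inr ⟨n, innerLoop₂ t⟩) (Sum.inl (earringLoop (2 * n + 1) t))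

/-- The Hawaiian pants: the quotient of the disjoint union of the Hawaiian earring and of countably
many pairs of pants by the equivalence relation generated by the identifications above. -/
def Space : Type := Quot Attach

/-- The quotient topology. -/
instance : TopologicalSpace Space := inferInstanceAs (TopologicalSpace (Quot Attach))

end

end HawaiianPants

/-- Two loops are freely homotopic if there is a homotopy between them through loops; the base
point may move during the homotopy. -/
def Path.FreelyHomotopic {X : Type*} [TopologicalSpace X] {x y : X} (γ : Path x x) (δ : Path y y) :
    Prop :=
  ContinuousMap.HomotopicWith (γ : C(I, X)) (δ : C(I, X)) (fun f => f 0 = f 1)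

/-- A loop is essential if it is not homotopic, relative to its endpoints, to a constant loop. -/
def Path.IsEssential {X : Type*} [TopologicalSpace X] {x : X} (γ : Path x x) : Prop :=
  ¬ γ.Homotopic (Path.refl x)

/-- Every essential loop `γ` admits an open neighborhood `U` of `x` such that `γ` is not freely
homotopic to any loop in `U`. -/
def StronglyHomotopicallyHausdorffAt (X : Type*) [TopologicalSpace X] (x : X) : Prop :=
  ∀ (b : X) (γ : Path b b), γ.IsEssential →
    ∃ U : Set X, IsOpen U ∧ x ∈ U ∧
      ∀ (y : X) (δ : Path y y), Set.range δ ⊆ U → ¬ γ.FreelyHomotopic δ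

/-- A strongly homotopically Hausdorff space: it is path-connected, and strongly homotopically
Hausdorff at each of its points. -/
def StronglyHomotopicallyHausdorff (X : Type*) [TopologicalSpace X] : Prop :=
  PathConnectedSpace X ∧ ∀ x : X, StronglyHomotopicallyHausdorffAt X x

/-! Away from the wedge point of the earring, every point has a neighborhood all of whose loops are
null-homotopic (`smallLoopsContract_or`), so only the wedge point is at issue. Suppose a loop can be
moved by free homotopies into every neighborhood of it. The collars of the pants retract onto the
earring, and near the origin the arcs of the finitely many circles of index at most `k + 1` slide
into the origin. For every `k` the loop is therefore freely homotopic, in the Hawaiian pants, to a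
loop in the circles of index greater than `k + 1`. If consecutive loops of this sequence were
homotopic inside the earring, those homotopies could be retracted onto the shrinking circles, and
their infinite concatenation would converge to a constant loop (`joined_const_of_shrinking`).

The difficulty is that the given homotopies may cross the pants. `joined_of_joined_map` replaces
them by homotopies in the earring, unless the loop is already null-homotopic there. Its proof is a
representation argument. Let `G` be the fundamental group of the earring. A class `d` with winding
numbers `w` acts on three copies of `G × ℤ^J`: by left multiplication by `d` on the first, and by
translation by `w` on the other two. Even in the large group `Rep` of all permutations commuting
with right translations by `G`, conjugacy of two such actions forces `d = 1` or conjugacy of the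
classes in `G` (`eq_one_or_conj_of_earringRep`).

The action extends over every pair of pants because there are commuting `x`, `y` such that `x * y`,
`x`, `y` are conjugate to the values on the three boundary circles
(`exists_commute_conj_earringRep`); the translation blocks absorb the superfluous elements of `G`.
Since `x` and `y` commute, two winding numbers describe the holonomy on the pants, and its
fundamental group is never computed. The conjugating elements enter as a discontinuous change of
gauge. The local holonomies agree on overlaps (`collarHol_eq_pantsHol`), and subdividing a free
homotopy compares its two ends up to conjugation (`exists_conj_of_freeHomotopy`). -/

namespace HawaiianPants

/-! ### Holonomies of paths -/

/-- The slice `t ↦ (s, t)` of the unit square. -/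
def sliceLeft (s : I) : C(I, I × I) := ⟨fun t => (s, t), by fun_prop⟩

/-- The slice `s ↦ (s, t)` of the unit square. -/
def sliceRight (t : I) : C(I, I × I) := ⟨fun s => (s, t), by fun_prop⟩

@[simp] theorem sliceLeft_apply (s t : I) : sliceLeft s t = (s, t) := rfl

@[simp] theorem sliceRight_apply (s t : I) : sliceRight t s = (s, t) := rfl

/-- The affine path from `a` to `b` in the unit interval. -/
def segment (a b : I) : C(I, I) := ⟨Set.Icc.convexComb a b, by fun_prop⟩

@[simp] theorem segment_zero (a b : I) : segment a b 0 = a := Set.Icc.convexComb_zero a b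

@[simp] theorem segment_one (a b : I) : segment a b 1 = b := Set.Icc.convexComb_one a b

theorem segment_mem {a b : I} (h : a ≤ b) (t : I) : segment a b t ∈ Set.Icc a b :=
  ⟨Set.Icc.le_convexComb h t, Set.Icc.convexComb_le h t⟩

theorem segment_self (a : I) : segment a a = ContinuousMap.const I a := by
  ext t; exact congrArg Subtype.val (Set.Icc.convexComb_eq a t)

theorem segment_zero_one : segment 0 1 = ContinuousMap.id I := by
  ext t; exact congrArg Subtype.val (Set.Icc.convexComb_zero_one t)

/-- A representation in `Λ` of the fundamental groupoid of `X`, given on parametrized paths. -/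
structure Holonomy (X : Type*) [TopologicalSpace X] (Λ : Type*) [Group Λ] where
  /-- The value on a path. -/
  hol : C(I, X) → Λ
  hol_const (x : X) : hol (ContinuousMap.const I x) = 1
  hol_square (K : C(I × I, X)) :
    hol (K.comp (sliceLeft 0)) * hol (K.comp (sliceRight 1)) =
      hol (K.comp (sliceRight 0)) * hol (K.comp (sliceLeft 1))

namespace Holonomy

variable {X Y Λ Γ : Type*} [TopologicalSpace X] [TopologicalSpace Y] [Group Λ] [Group Γ]

/-- Precomposition with a continuous map. -/
def pullback (h : Holonomy Y Λ) (f : C(X, Y)) : Holonomy X Λ where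
  hol g := h.hol (f.comp g)
  hol_const x := h.hol_const (f x)
  hol_square K := h.hol_square (f.comp K)

/-- Postcomposition with a group homomorphism. -/
def map (h : Holonomy X Λ) (φ : Λ →* Γ) : Holonomy X Γ where
  hol g := φ (h.hol g)
  hol_const x := by rw [h.hol_const, map_one]
  hol_square K := by rw [← map_mul, h.hol_square, map_mul]

/-- The product of two holonomies. -/
def prod (h : Holonomy X Λ) (k : Holonomy X Γ) : Holonomy X (Λ × Γ) where
  hol g := (h.hol g, k.hol g)
  hol_const x := by rw [h.hol_const, k.hol_const]; rfl
  hol_square K := by rw [Prod.mk_mul_mk, h.hol_square, k.hol_square]; rfl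

/-- The product of a family of holonomies. -/
def pi {ι : Type*} {Λ : ι → Type*} [∀ i, Group (Λ i)] (h : ∀ i, Holonomy X (Λ i)) :
    Holonomy X (∀ i, Λ i) where
  hol g i := (h i).hol g
  hol_const x := funext fun i => (h i).hol_const x
  hol_square K := funext fun i => (h i).hol_square K

/-- Change of gauge by a function with values in the group. -/
def gauge (h : Holonomy X Λ) (τ : X → Λ) : Holonomy X Λ where
  -- No continuity of `τ` is needed, and the gauges used later do jump.
  hol g := (τ (g 0))⁻¹ * h.hol g * τ (g 1)
  hol_const x := by rw [h.hol_const]; simp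
  hol_square K := by
    have := h.hol_square K
    simp only [ContinuousMap.comp_apply, sliceLeft_apply, sliceRight_apply]
    calc _ = (τ (K (0, 0)))⁻¹ * (h.hol (K.comp (sliceLeft 0)) * h.hol (K.comp (sliceRight 1)))
          * τ (K (1, 1)) := by group
      _ = _ := by rw [this]; group

/-- Multiplicativity under concatenation is the square relation for a square with one side collapsed
to `g a`; the other sides run from `a` to `b`, from `b` to `c` and from `a` to `c`. -/
theorem hol_segment_mul (h : Holonomy X Λ) (g : C(I, X)) (a b c : I) :
    h.hol (g.comp (segment a b)) * h.hol (g.comp (segment b c)) =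
      h.hol (g.comp (segment a c)) := by
  let K : C(I × I, X) := ⟨fun p => g (segment a (segment b c p.1) p.2), by
    have : Continuous fun p : I × I => segment a (segment b c p.1) p.2 :=
      Set.Icc.continuous_convexComb_prod.comp
        (continuous_const.prodMk (((segment b c).continuous.comp continuous_fst).prodMk
          continuous_snd))
    exact g.continuous.comp this⟩
  have h1 := h.hol_square K
  have e1 : K.comp (sliceLeft 0) = g.comp (segment a b) := by ext t; simp [K]
  have e2 : K.comp (sliceRight 1) = g.comp (segment b c) := by ext t; simp [K]
  have e3 : K.comp (sliceRight 0) = ContinuousMap.const I (g a) := by ext t; simp [K]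
  have e4 : K.comp (sliceLeft 1) = g.comp (segment a c) := by ext t; simp [K]
  rw [e1, e2, e3, e4, h.hol_const, one_mul] at h1
  exact h1

/-- Curves that are homotopic relative to their endpoints have the same holonomy. -/
theorem hol_eq_of_sides (h : Holonomy X Λ) (K : C(I × I, X)) {x y : X}
    (hx : ∀ s, K (s, 0) = x) (hy : ∀ s, K (s, 1) = y) :
    h.hol (K.comp (sliceLeft 0)) = h.hol (K.comp (sliceLeft 1)) := by
  have h1 := h.hol_square K
  have e2 : K.comp (sliceRight 1) = ContinuousMap.const I y := by ext t; simp [hy]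
  have e3 : K.comp (sliceRight 0) = ContinuousMap.const I x := by ext t; simp [hx]
  rwa [e2, e3, h.hol_const, h.hol_const, one_mul, mul_one] at h1

end Holonomy

/-! ### Gluing local holonomies over an open cover -/

section Cover

variable {X Λ ι : Type*} [TopologicalSpace X] [Group Λ] {U : ι → Set X}

/-- Restriction of the codomain of a continuous map to a set that contains its range. -/
def corestrict {Z : Type*} [TopologicalSpace Z] (g : C(Z, X)) (S : Set X) (hg : ∀ t, g t ∈ S) :
    C(Z, S) := ⟨fun t => ⟨g t, hg t⟩, by fun_prop⟩

open Classical in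
/-- The value of a family of holonomies, one on each set of a cover, on a path contained in one of
the sets. -/
noncomputable def localHol (h : ∀ i, Holonomy (U i) Λ) (g : C(I, X)) : Λ :=
  if hg : ∃ i, ∀ t, g t ∈ U i then (h hg.choose).hol (corestrict g _ hg.choose_spec) else 1

theorem localHol_eq {h : ∀ i, Holonomy (U i) Λ}
    (compat : ∀ i j (g : C(I, X)) (hi : ∀ t, g t ∈ U i) (hj : ∀ t, g t ∈ U j),
      (h i).hol (corestrict g _ hi) = (h j).hol (corestrict g _ hj))
    {g : C(I, X)} {i : ι} (hi : ∀ t, g t ∈ U i) :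
    localHol h g = (h i).hol (corestrict g _ hi) := by
  rw [localHol, dif_pos ⟨i, hi⟩]
  exact compat _ _ _ _ _

/-- The product of local holonomies along a subdivided path. -/
noncomputable def subdividedHol (h : ∀ i, Holonomy (U i) Λ) (g : C(I, X)) (t : ℕ → I) : ℕ → Λ
  | 0 => 1
  | n + 1 => subdividedHol h g t n * localHol h (g.comp (segment (t n) (t (n + 1))))

theorem subdividedHol_eq {h : ∀ i, Holonomy (U i) Λ}
    (compat : ∀ i j (g : C(I, X)) (hi : ∀ t, g t ∈ U i) (hj : ∀ t, g t ∈ U j),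
      (h i).hol (corestrict g _ hi) = (h j).hol (corestrict g _ hj))
    {g : C(I, X)} {i : ι} (hi : ∀ t, g t ∈ U i) (t : ℕ → I) (n : ℕ) :
    subdividedHol h g t n = (h i).hol ((corestrict g _ hi).comp (segment (t 0) (t n))) := by
  induction n with
  | zero => rw [segment_self]; exact ((h i).hol_const (corestrict g _ hi (t 0))).symm
  | succ n ih =>
    rw [subdividedHol, ih, localHol_eq (g := g.comp (segment (t n) (t (n + 1)))) compat
      (i := i) fun s => hi _, ← (h i).hol_segment_mul _ (t 0) (t n) (t (n + 1))]
    rfl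

/-- Holonomies on the sets of an open cover that agree on overlaps give conjugate values on two
freely homotopic loops. -/
theorem exists_conj_of_freeHomotopy {h : ∀ i, Holonomy (U i) Λ} (hU : ∀ i, IsOpen (U i))
    (hcov : ⋃ i, U i = Set.univ)
    (compat : ∀ i j (g : C(I, X)) (hi : ∀ t, g t ∈ U i) (hj : ∀ t, g t ∈ U j),
      (h i).hol (corestrict g _ hi) = (h j).hol (corestrict g _ hj))
    (F : C(I × I, X)) (hF : ∀ s, F (s, 0) = F (s, 1)) {i j : ι}
    (hi : ∀ t, F.comp (sliceLeft 0) t ∈ U i) (hj : ∀ t, F.comp (sliceLeft 1) t ∈ U j) :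
    ∃ c : Λ, (h i).hol (corestrict _ _ hi) * c = c * (h j).hol (corestrict _ _ hj) := by
  -- By compactness finitely many boxes suffice, each mapped into one set of the cover, although the
  -- cover may be infinite.
  obtain ⟨t, t0, tmono, ⟨N, hN⟩, hbox⟩ :=
    exists_monotone_Icc_subset_open_cover_unitInterval_prod_self (c := fun i => F ⁻¹' U i)
      (fun i => (hU i).preimage F.continuous)
      (by rw [← Set.preimage_iUnion, hcov, Set.preimage_univ])
  have box (n m : ℕ) :
      localHol h ((F.comp (sliceLeft (t n))).comp (segment (t m) (t (m + 1)))) *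
        localHol h ((F.comp (sliceRight (t (m + 1)))).comp (segment (t n) (t (n + 1)))) =
      localHol h ((F.comp (sliceRight (t m))).comp (segment (t n) (t (n + 1)))) *
        localHol h ((F.comp (sliceLeft (t (n + 1)))).comp (segment (t m) (t (m + 1)))) := by
    obtain ⟨k, hk⟩ := hbox n m
    have hk' : ∀ p q : I, F (segment (t n) (t (n + 1)) p, segment (t m) (t (m + 1)) q) ∈ U k :=
      fun p q => hk ⟨segment_mem (tmono n.le_succ) p, segment_mem (tmono m.le_succ) q⟩
    let K : C(I × I, U k) := ⟨fun p => ⟨F (segment (t n) (t (n + 1)) p.1,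
      segment (t m) (t (m + 1)) p.2), hk' _ _⟩, by fun_prop⟩
    have := (h k).hol_square K
    rw [localHol_eq compat (i := k), localHol_eq compat (i := k), localHol_eq compat (i := k),
      localHol_eq compat (i := k)]
    · convert this using 3 <;> ext p <;> simp [K, corestrict]
    all_goals
      intro p
      first
        | simpa using hk' 0 p
        | simpa using hk' p 1
        | simpa using hk' p 0
        | simpa using hk' 1 p
  -- Adjacent boxes share an edge whose value cancels, so the square relation propagates along a row
  -- and then, in `grid`, over all rows.
  have strip (n m : ℕ) :
      subdividedHol h (F.comp (sliceLeft (t n))) t m *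
        localHol h ((F.comp (sliceRight (t m))).comp (segment (t n) (t (n + 1)))) =
      localHol h ((F.comp (sliceRight (t 0))).comp (segment (t n) (t (n + 1)))) *
        subdividedHol h (F.comp (sliceLeft (t (n + 1)))) t m := by
    induction m with
    | zero => simp [subdividedHol]
    | succ m ih => rw [subdividedHol, mul_assoc, box, ← mul_assoc, ih, mul_assoc]; rfl
  have grid (n m : ℕ) :
      subdividedHol h (F.comp (sliceLeft (t 0))) t m *
        subdividedHol h (F.comp (sliceRight (t m))) t n =
      subdividedHol h (F.comp (sliceRight (t 0))) t n *
        subdividedHol h (F.comp (sliceLeft (t n))) t m := by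
    induction n with
    | zero => simp [subdividedHol]
    | succ n ih => rw [subdividedHol, ← mul_assoc, ih, mul_assoc, strip, ← mul_assoc]; rfl
  have key := grid N N
  rw [hN N le_rfl, t0] at key
  -- The two remaining sides coincide because the homotopy runs through loops; their common value is
  -- the conjugating element.
  have e : F.comp (sliceRight 1) = F.comp (sliceRight 0) := by ext s; exact (hF s).symm
  rw [e, subdividedHol_eq compat hi, subdividedHol_eq compat hj, t0, hN N le_rfl,
    segment_zero_one] at key
  exact ⟨_, key⟩

end Cover

end HawaiianPants

namespace HawaiianPants

/-! ### The target group and the pants relation in it -/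

section Algebra

variable {G J S κ : Type*} [Group G]

/-- The permutations of `G × S` that commute with the right translations by `G`. -/
def equivariantPerm (G S : Type*) [Group G] : Subgroup (Equiv.Perm (G × S)) where
  carrier := {c | ∀ g h s, c (g * h, s) = ((c (g, s)).1 * h, (c (g, s)).2)}
  one_mem' _ _ _ := rfl
  mul_mem' {c d} hc hd g h s := by
    rw [Equiv.Perm.mul_apply, hd, hc]; rfl
  inv_mem' {c} hc g h s := by
    rw [Equiv.Perm.inv_eq_iff_eq, hc]
    simp

/-- Left multiplication on `G` together with translation on `J → ℤ`. -/
def translation : G × Multiplicative (J → ℤ) →* Equiv.Perm (G × (J → ℤ)) where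
  toFun x :=
    { toFun := fun p => (x.1 * p.1, x.2.toAdd + p.2)
      invFun := fun p => (x.1⁻¹ * p.1, -x.2.toAdd + p.2)
      left_inv := fun p => by simp
      right_inv := fun p => by simp }
  map_one' := by ext p <;> simp
  map_mul' x y := by ext p <;> simp [mul_assoc, add_assoc]

theorem translation_apply (d : G) (w : J → ℤ) (p : G × (J → ℤ)) :
    translation (d, Multiplicative.ofAdd w) p = (d * p.1, w + p.2) := rfl

theorem translation_mem (x : G × Multiplicative (J → ℤ)) :
    translation x ∈ equivariantPerm G (J → ℤ) := by
  intro g h s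
  simp [translation, mul_assoc]

/-- A permutation of `G × (J → ℤ)` that conjugates a unit translation to another one, up to sign
and multiplication by `h`. -/
def twist [DecidableEq J] (ε : ℤˣ) (h : G) (i j : J) : Equiv.Perm (G × (J → ℤ)) where
  toFun p := (h ^ p.2 i * p.1, fun k => (ε : ℤ) * p.2 (Equiv.swap i j k))
  invFun p := (h ^ (-((ε : ℤ) * p.2 j)) * p.1, fun k => (ε : ℤ) * p.2 (Equiv.swap i j k))
  left_inv p := by
    ext k
    · simp [← mul_assoc, Int.units_coe_mul_self]
    · simp [← mul_assoc, Int.units_coe_mul_self]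
  right_inv p := by
    ext k
    · simp
    · simp [← mul_assoc, Int.units_coe_mul_self]

theorem twist_mem [DecidableEq J] (ε : ℤˣ) (h : G) (i j : J) :
    twist ε h i j ∈ equivariantPerm G (J → ℤ) := by
  intro g k s
  simp [twist, mul_assoc]

/-- Translation by `e_i` raises the exponent `p.2 i` by one and so produces exactly one factor `h`,
while the swap and the sign turn `e_i` into `ε e_j`. A nonzero translation can thus absorb any
element of `G` up to conjugacy. -/
theorem twist_mul_translation [DecidableEq J] (ε : ℤˣ) (h : G) (i j : J) :
    twist ε h i j * translation (1, Multiplicative.ofAdd (Pi.single i 1)) =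
      translation (h, Multiplicative.ofAdd (Pi.single j (ε : ℤ))) * twist ε h i j := by
  ext p k
  · simp [twist, translation_apply, zpow_add, mul_assoc]
  · rcases eq_or_ne k j with rfl | hk
    · simp [twist, translation_apply, mul_add]
    · have : Equiv.swap i j k ≠ i := by
        rw [Ne, Equiv.swap_apply_eq_iff, Equiv.swap_apply_left]; exact hk
      simp [twist, translation_apply, mul_add, Pi.single_apply, hk, this]

/-- The permutation of `G × (S × κ)` that acts on each slice `G × (S × {i})` by a given one. -/
def blockDiagonal : (κ → Equiv.Perm (G × S)) →* Equiv.Perm (G × (S × κ)) where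
  toFun q :=
    { toFun := fun p => ((q p.2.2 (p.1, p.2.1)).1, (q p.2.2 (p.1, p.2.1)).2, p.2.2)
      invFun := fun p =>
        (((q p.2.2).symm (p.1, p.2.1)).1, ((q p.2.2).symm (p.1, p.2.1)).2, p.2.2)
      left_inv := fun p => by simp
      right_inv := fun p => by simp }
  map_one' := rfl
  map_mul' _ _ := rfl

theorem blockDiagonal_apply (q : κ → Equiv.Perm (G × S)) (g : G) (s : S) (i : κ) :
    blockDiagonal q (g, s, i) = ((q i (g, s)).1, (q i (g, s)).2, i) := rfl

theorem blockDiagonal_mem {q : κ → Equiv.Perm (G × S)} (hq : ∀ i, q i ∈ equivariantPerm G S) :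
    blockDiagonal q ∈ equivariantPerm G (S × κ) := by
  rintro g h ⟨s, i⟩
  simp only [blockDiagonal_apply]
  rw [hq i g h s]

/-- The permutation of `G × (S × κ)` induced by a permutation of `κ`. -/
def blockPerm (e : Equiv.Perm κ) : Equiv.Perm (G × (S × κ)) :=
  Equiv.prodCongr (Equiv.refl G) (Equiv.prodCongr (Equiv.refl S) e)

theorem blockPerm_mem (e : Equiv.Perm κ) : blockPerm e ∈ equivariantPerm G (S × κ) :=
  fun _ _ _ => rfl

theorem blockPerm_mul_blockDiagonal (e : Equiv.Perm κ) (q q' : κ → Equiv.Perm (G × S))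
    (h : ∀ i, q' (e i) = q i) :
    blockPerm e * blockDiagonal q = blockDiagonal q' * blockPerm e := by
  ext1 ⟨g, s, i⟩
  simp [blockPerm, blockDiagonal_apply, h]

/-- The group in which the fundamental groupoid of the Hawaiian pants is represented. -/
abbrev Rep (G J : Type*) [Group G] := equivariantPerm G ((J → ℤ) × Fin 3)

/-- The representation of a class of loops `d` in the earring with winding numbers `w`. -/
def earringRep : G × Multiplicative (J → ℤ) →* Rep G J where
  -- Block 0 retains the class in `G`; the other two see only winding numbers and provide the room
  -- to satisfy the pants relation.
  toFun x := ⟨blockDiagonal ![translation (x.1, 1), translation (1, x.2), translation (1, x.2)],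
    blockDiagonal_mem fun i => by fin_cases i <;> exact translation_mem _⟩
  map_one' := by
    ext1
    simp only [Prod.fst_one, Prod.snd_one, ← Prod.one_eq_mk, map_one, OneMemClass.coe_one]
    rw [show (![1, 1, 1] : Fin 3 → Equiv.Perm (G × (J → ℤ))) = 1 by ext1 i; fin_cases i <;> rfl,
      map_one]
  map_mul' x y := by
    ext1
    simp only [Subgroup.coe_mul]
    rw [← map_mul]
    congr 1
    ext1 i
    fin_cases i
    · simp [← map_mul]
    · simp [← map_mul]
    · simp [← map_mul]

/-- Follow the point `(1, 0, 0)` under `c⁻¹` to some `(g, v, i)`. By equivariance, acting by `d` in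
block 0 becomes right multiplication of `g` by `d`. If `i = 0`, the other side gives `d' * g`; in
the translation blocks the `G`-coordinate does not move, so `g * d = g`. -/
theorem eq_one_or_conj_of_earringRep {d d' : G} {w w' : Multiplicative (J → ℤ)} {c : Rep G J}
    (h : earringRep (d, w) * c = c * earringRep (d', w')) : d = 1 ∨ ∃ g : G, g * d = d' * g := by
  have h' : c⁻¹ * earringRep (d, w) = earringRep (d', w') * c⁻¹ := by
    rw [inv_mul_eq_iff_eq_mul, ← mul_assoc, ← h, mul_inv_cancel_right]
  have h1 := congrArg (fun x : Rep G J => x.1 (1, 0, 0)) h'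
  simp only [Subgroup.coe_mul, Equiv.Perm.mul_apply] at h1
  have h2 : (earringRep (d, w)).1 (1, (0 : J → ℤ), (0 : Fin 3)) = (1 * d, 0, 0) := by
    change blockDiagonal _ _ = _
    rw [blockDiagonal_apply]
    simp [translation]
  rw [h2, (c⁻¹).2 1 d] at h1
  generalize (c⁻¹).1 (1, 0, 0) = q at h1
  obtain ⟨g, v, i⟩ := q
  change _ = blockDiagonal _ _ at h1
  rw [blockDiagonal_apply] at h1
  fin_cases i
  · right
    exact ⟨g, by simpa [translation] using congrArg Prod.fst h1⟩
  · left
    simpa [translation] using congrArg Prod.fst h1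
  · left
    simpa [translation] using congrArg Prod.fst h1

/-- In block 0 of `x * y` the translations by `e_b` and `-e_b` cancel and left multiplication by
`la` remains. Blocks 1 and 2 are `(lb, e_c)` and `(lc, e_b)`, which twists conjugate to `(1, e_a)`.
Swapping blocks 0 and 1 turns `x` into the value for `lb`. For `y`, a twist first replaces `(la,
-e_b)` in block 0 by `(1, e_c)`, and then blocks 0 and 2 are swapped. -/
theorem exists_commute_conj_earringRep [DecidableEq J] (a b c : J) (la lb lc : G) :
    ∃ x y p u w : Rep G J, Commute x y ∧
      earringRep (la, Multiplicative.ofAdd (Pi.single a 1)) * p = p * (x * y) ∧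
      earringRep (lb, Multiplicative.ofAdd (Pi.single b 1)) * u = u * x ∧
      earringRep (lc, Multiplicative.ofAdd (Pi.single c 1)) * w = w * y := by
  let T (h : G) (j : J) (n : ℤ) : Equiv.Perm (G × (J → ℤ)) :=
    translation (h, Multiplicative.ofAdd (Pi.single j n))
  have hT (h j n) : T h j n ∈ equivariantPerm G (J → ℤ) := translation_mem _
  have hmul (h k : G) (i j : J) (n m : ℤ) : T h i n * T k j m =
      translation (h * k, Multiplicative.ofAdd (Pi.single i n + Pi.single j m)) := by
    simp only [T, ← map_mul, Prod.mk_mul_mk, ofAdd_add]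
  let x : Fin 3 → Equiv.Perm (G × (J → ℤ)) := ![T 1 b 1, T lb b 0, T 1 b 1]
  let y : Fin 3 → Equiv.Perm (G × (J → ℤ)) := ![T la b (-1), T 1 c 1, T lc c 0]
  have hx : ∀ i, x i ∈ equivariantPerm G (J → ℤ) := by
    intro i; fin_cases i <;> exact hT _ _ _
  have hy : ∀ i, y i ∈ equivariantPerm G (J → ℤ) := by
    intro i; fin_cases i <;> exact hT _ _ _
  let p : Fin 3 → Equiv.Perm (G × (J → ℤ)) := ![1, (twist 1 lb a c)⁻¹, (twist 1 lc a b)⁻¹]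
  have hp : ∀ i, p i ∈ equivariantPerm G (J → ℤ) := by
    intro i; fin_cases i
    · exact one_mem _
    · exact inv_mem (twist_mem _ _ _ _)
    · exact inv_mem (twist_mem _ _ _ _)
  let s : Fin 3 → Equiv.Perm (G × (J → ℤ)) := ![(twist (-1) la c b)⁻¹, 1, 1]
  have hs : ∀ i, s i ∈ equivariantPerm G (J → ℤ) := by
    intro i; fin_cases i
    · exact inv_mem (twist_mem _ _ _ _)
    · exact one_mem _
    · exact one_mem _
  have twist_inv (ε : ℤˣ) (h : G) (i j : J) :
      T 1 i 1 * (twist ε h i j)⁻¹ = (twist ε h i j)⁻¹ * T h j ε := by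
    rw [eq_inv_mul_iff_mul_eq, ← mul_assoc, twist_mul_translation, mul_inv_cancel_right]
  refine ⟨⟨blockDiagonal x, blockDiagonal_mem hx⟩, ⟨blockDiagonal y, blockDiagonal_mem hy⟩,
    ⟨blockDiagonal p, blockDiagonal_mem hp⟩, ⟨blockPerm (Equiv.swap 0 1), blockPerm_mem _⟩,
    ⟨blockPerm (Equiv.swap 0 2), blockPerm_mem _⟩ * ⟨blockDiagonal s, blockDiagonal_mem hs⟩,
    ?_, ?_, ?_, ?_⟩
  · ext1
    change blockDiagonal x * blockDiagonal y = blockDiagonal y * blockDiagonal x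
    rw [← map_mul, ← map_mul]
    congr 1
    ext1 i
    fin_cases i
    · simp only [Pi.mul_apply, x, y]
      change T _ _ _ * T _ _ _ = T _ _ _ * T _ _ _
      rw [hmul, hmul, add_comm, mul_one, one_mul]
    · change T _ _ _ * T _ _ _ = T _ _ _ * T _ _ _
      rw [hmul, hmul, add_comm, mul_one, one_mul]
    · change T _ _ _ * T _ _ _ = T _ _ _ * T _ _ _
      rw [hmul, hmul, add_comm, mul_one, one_mul]
  · ext1
    change blockDiagonal _ * blockDiagonal p =
      blockDiagonal p * (blockDiagonal x * blockDiagonal y)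
    rw [← map_mul, ← map_mul, ← map_mul]
    congr 1
    ext1 i
    fin_cases i
    · change translation _ * 1 = 1 * (T _ _ _ * T _ _ _)
      rw [hmul]
      simp [← Pi.single_add]
    · change T 1 a 1 * (twist 1 lb a c)⁻¹ = (twist 1 lb a c)⁻¹ * (T _ _ _ * T _ _ _)
      rw [hmul, twist_inv]
      simp [T]
    · change T 1 a 1 * (twist 1 lc a b)⁻¹ = (twist 1 lc a b)⁻¹ * (T _ _ _ * T _ _ _)
      rw [hmul, twist_inv]
      simp [T]
  · ext1
    change blockDiagonal _ * blockPerm _ = blockPerm _ * blockDiagonal x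
    rw [blockPerm_mul_blockDiagonal]
    intro i
    fin_cases i
    · rfl
    · simp [x, T]
    · rfl
  · ext1
    change blockDiagonal _ * (blockPerm _ * blockDiagonal s) =
      blockPerm _ * blockDiagonal s * blockDiagonal y
    rw [← mul_assoc, ← blockPerm_mul_blockDiagonal (Equiv.swap 0 2) ![T 1 c 1, T 1 c 1, T lc c 0],
      mul_assoc, mul_assoc, ← map_mul, ← map_mul]
    · congr 2
      ext1 i
      fin_cases i
      · change T 1 c 1 * (twist (-1) la c b)⁻¹ = (twist (-1) la c b)⁻¹ * T _ _ _
        rw [twist_inv]; simp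
      · rfl
      · rfl
    · intro i
      fin_cases i
      · rfl
      · rfl
      · simp [T]

end Algebra

end HawaiianPants

namespace HawaiianPants

noncomputable section

/-! ### Angles and crossing numbers in the punctured plane -/

instance : ContractibleSpace I := (convex_Icc (0 : ℝ) 1).contractibleSpace ⟨0, by simp⟩

instance : LocallyPathConnectedSpace I := (convex_Icc (0 : ℝ) 1).locallyPathConnectedSpace

/-- The nonzero complex numbers. -/
abbrev PuncturedPlane : Type := {z : ℂ // z ≠ 0}

/-- The clockwise parametrization `θ ↦ -exp (-2πiθ)` of the unit circle. -/
def clockwiseUnit (θ : ℝ) : ℂ := -Complex.exp (-(2 * Real.pi * θ * Complex.I))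

theorem continuous_clockwiseUnit : Continuous clockwiseUnit := by
  unfold clockwiseUnit; fun_prop

theorem clockwiseUnit_eq (θ : ℝ) :
    clockwiseUnit θ = Complex.exp (((Real.pi - 2 * Real.pi * θ : ℝ) : ℂ) * Complex.I) := by
  rw [clockwiseUnit, Complex.ofReal_sub, sub_mul, Complex.exp_sub, Complex.exp_pi_mul_I,
    Complex.exp_neg]
  push_cast
  field_simp

theorem norm_clockwiseUnit (θ : ℝ) : ‖clockwiseUnit θ‖ = 1 := by
  rw [clockwiseUnit_eq, Complex.norm_exp_ofReal_mul_I]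

theorem clockwiseUnit_eq_iff {θ θ' : ℝ} :
    clockwiseUnit θ = clockwiseUnit θ' ↔ ∃ n : ℤ, θ' = θ + n := by
  rw [clockwiseUnit_eq, clockwiseUnit_eq, Complex.exp_eq_exp_iff_exists_int]
  have hpi := Real.pi_pos
  constructor
  · rintro ⟨n, hn⟩
    refine ⟨n, ?_⟩
    have := congrArg Complex.im hn
    simp at this
    have : 2 * Real.pi * (θ' - (θ + n)) = 0 := by linarith
    rcases mul_eq_zero.1 this with h | h
    · linarith
    · linarith
  · rintro ⟨n, rfl⟩
    refine ⟨n, ?_⟩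
    push_cast
    ring

/-- The parameter in `[0, 1)` of the direction of a complex number. -/
def angleParam (z : ℂ) : ℝ := 1 / 2 - z.arg / (2 * Real.pi)

theorem angleParam_nonneg (z : ℂ) : 0 ≤ angleParam z := by
  have := Real.pi_pos
  rw [angleParam, sub_nonneg, div_le_iff₀ (by positivity)]
  linarith [z.arg_le_pi]

theorem angleParam_lt_one (z : ℂ) : angleParam z < 1 := by
  have := Real.pi_pos
  rw [angleParam, sub_lt_comm, lt_div_iff₀ (by positivity)]
  linarith [z.neg_pi_lt_arg]

theorem norm_mul_clockwiseUnit_angleParam (z : ℂ) :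
    ‖z‖ * clockwiseUnit (angleParam z) = z := by
  rw [clockwiseUnit_eq, angleParam]
  rw [show Real.pi - 2 * Real.pi * (1 / 2 - z.arg / (2 * Real.pi)) = z.arg by
    field_simp; ring]
  exact Complex.norm_mul_exp_arg_mul_I z

/-- `θ` is a choice of angles for `f`. -/
def IsAngle {A : Type*} (f : A → ℂ) (θ : A → ℝ) : Prop := ∀ a, f a = ‖f a‖ * clockwiseUnit (θ a)

/-- The angle is read off from the imaginary part of a lift through the covering `exp`. -/
theorem exists_isAngle {A : Type*} [TopologicalSpace A] [SimplyConnectedSpace A]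
    [LocallyPathConnectedSpace A] (f : C(A, PuncturedPlane)) :
    ∃ θ : C(A, ℝ), IsAngle (fun a => (f a : ℂ)) θ := by
  obtain ⟨a₀⟩ : Nonempty A := inferInstance
  obtain ⟨F, ⟨-, hF⟩, -⟩ := Complex.isCoveringMap_exp.existsUnique_continuousMap_lifts f a₀
    (Complex.log (f a₀)) (Subtype.ext (Complex.exp_log (f a₀).2))
  refine ⟨⟨fun a => 1 / 2 - (F a).im / (2 * Real.pi), by fun_prop⟩, fun a => ?_⟩
  have h : Complex.exp (F a) = f a := congrArg Subtype.val (congrFun hF a)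
  dsimp only [ContinuousMap.coe_mk]
  have hpi := Real.pi_pos
  rw [clockwiseUnit_eq, ← h, show Real.pi - 2 * Real.pi * (1 / 2 - (F a).im / (2 * Real.pi))
    = (F a).im by field_simp; ring, Complex.norm_exp, Complex.ofReal_exp, ← Complex.exp_add,
    Complex.re_add_im]

/-- The difference of two angle functions is continuous and integer-valued on a connected space. -/
theorem IsAngle.exists_int {f : C(I, PuncturedPlane)} {θ θ' : C(I, ℝ)}
    (h : IsAngle (fun a => (f a : ℂ)) θ) (h' : IsAngle (fun a => (f a : ℂ)) θ') :
    ∃ n : ℤ, ∀ a, θ' a = θ a + n := by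
  have hd : ∀ a, ∃ n : ℤ, θ' a = θ a + n := fun a => by
    have h1 := (h a).symm.trans (h' a)
    have h0 : (‖(f a : ℂ)‖ : ℂ) ≠ 0 := by
      rw [Ne, Complex.ofReal_eq_zero, norm_eq_zero]; exact (f a).2
    exact clockwiseUnit_eq_iff.1 (mul_left_cancel₀ h0 h1)
  choose n hn using hd
  have hc : Continuous n := by
    rw [Int.isClosedEmbedding_coe_real.isInducing.continuous_iff]
    have : (fun z : ℤ => (z : ℝ)) ∘ n = fun a => θ' a - θ a := by
      ext a; simp [hn a]
    rw [this]; fun_prop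
  exact ⟨n 0, fun a => by rw [hn a, PreconnectedSpace.constant inferInstance hc (y := 0)]⟩

/-- The signed number of times that a path in the punctured plane crosses the negative real
axis. -/
def crossing (f : C(I, PuncturedPlane)) : ℤ :=
  ⌊(exists_isAngle f).choose 1⌋ - ⌊(exists_isAngle f).choose 0⌋

theorem IsAngle.crossing_eq {f : C(I, PuncturedPlane)} {θ : C(I, ℝ)}
    (h : IsAngle (fun a => (f a : ℂ)) θ) : crossing f = ⌊θ 1⌋ - ⌊θ 0⌋ := by
  obtain ⟨n, hn⟩ := h.exists_int (exists_isAngle f).choose_spec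
  rw [crossing, hn, hn, Int.floor_add_intCast, Int.floor_add_intCast]
  ring

/-- The number of crossings as a holonomy. -/
def crossingHol : Holonomy PuncturedPlane (Multiplicative ℤ) where
  hol f := Multiplicative.ofAdd (crossing f)
  hol_const x := by
    have h : IsAngle (fun a => (ContinuousMap.const I x a : ℂ))
        (ContinuousMap.const I (angleParam x)) :=
      fun a => (norm_mul_clockwiseUnit_angleParam _).symm
    rw [h.crossing_eq]; simp
  hol_square K := by
    -- An angle function on the whole square restricts to all four sides, and the floors at the
    -- corners telescope.
    obtain ⟨θ, hθ⟩ := exists_isAngle K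
    have h1 (s : I) : IsAngle (fun a => (K.comp (sliceLeft s) a : ℂ)) (θ.comp (sliceLeft s)) :=
      fun a => hθ _
    have h2 (s : I) : IsAngle (fun a => (K.comp (sliceRight s) a : ℂ)) (θ.comp (sliceRight s)) :=
      fun a => hθ _
    rw [(h1 0).crossing_eq, (h1 1).crossing_eq, (h2 0).crossing_eq, (h2 1).crossing_eq,
      ← ofAdd_add, ← ofAdd_add]
    congr 1
    simp

theorem continuousOn_arg_slitPlane : ContinuousOn Complex.arg Complex.slitPlane :=
  fun _ hz => (Complex.continuousAt_arg hz).continuousWithinAt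

/-- Off the cut the principal angle is continuous and stays in `[0, 1)`. -/
theorem crossing_eq_zero {f : C(I, PuncturedPlane)} (hf : ∀ t, (f t : ℂ) ∈ Complex.slitPlane) :
    crossing f = 0 := by
  have hpi := Real.pi_pos
  have hc : Continuous fun t => angleParam (f t) := by
    have : Continuous fun t => (f t : ℂ).arg :=
      continuousOn_arg_slitPlane.comp_continuous (by fun_prop) hf
    unfold angleParam
    fun_prop
  have h : IsAngle (fun a => (f a : ℂ)) (⟨_, hc⟩ : C(I, ℝ)) :=
    fun a => (norm_mul_clockwiseUnit_angleParam _).symm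
  have h0 (z : ℂ) : ⌊angleParam z⌋ = 0 :=
    Int.floor_eq_zero_iff.2 ⟨angleParam_nonneg z, angleParam_lt_one z⟩
  rw [h.crossing_eq]
  simp [h0]

/-- The difference between the numbers of crossings of `f` and `f * v` is the variation of this
function, when `v` has values in the slit plane. -/
def crossingShift (z v : ℂ) : ℤ := ⌊angleParam z - v.arg / (2 * Real.pi)⌋

/-- Subtracting the principal argument of `v` from an angle of `f` gives an angle of `f * v`. The
resulting change of the floor depends only on the values of `f` and `v` at the point, since shifting
the angle by an integer shifts both floors. So the two crossing numbers differ by a change of gauge.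
-/
theorem crossing_mul {f f' : C(I, PuncturedPlane)} {v : C(I, ℂ)}
    (hv : ∀ t, v t ∈ Complex.slitPlane) (hf : ∀ t, (f' t : ℂ) = f t * v t) :
    crossing f' = crossing f + crossingShift (f 1) (v 1) - crossingShift (f 0) (v 0) := by
  have hpi := Real.pi_pos
  obtain ⟨θ, hθ⟩ := exists_isAngle f
  have hc : Continuous fun t => θ t - (v t).arg / (2 * Real.pi) := by
    have : Continuous fun t => (v t).arg :=
      continuousOn_arg_slitPlane.comp_continuous (by fun_prop) hv
    fun_prop
  have h' : IsAngle (fun a => (f' a : ℂ)) (⟨_, hc⟩ : C(I, ℝ)) := fun a => by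
    have h1 : (f a : ℂ) = ‖(f a : ℂ)‖ * clockwiseUnit (θ a) := hθ a
    have h2 := Complex.norm_mul_exp_arg_mul_I (v a)
    simp only [ContinuousMap.coe_mk]
    rw [hf a, norm_mul, clockwiseUnit_eq]
    rw [clockwiseUnit_eq] at h1
    rw [show Real.pi - 2 * Real.pi * (θ a - (v a).arg / (2 * Real.pi)) =
      (Real.pi - 2 * Real.pi * θ a) + (v a).arg by field_simp; ring, Complex.ofReal_add, add_mul,
      Complex.exp_add, Complex.ofReal_mul]
    conv_lhs => rw [h1, ← h2]
    ring
  have key (t : I) : ⌊θ t - (v t).arg / (2 * Real.pi)⌋ =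
      ⌊θ t⌋ + crossingShift (f t) (v t) := by
    have h0 : (‖(f t : ℂ)‖ : ℂ) ≠ 0 := by
      rw [Ne, Complex.ofReal_eq_zero, norm_eq_zero]; exact (f t).2
    obtain ⟨n, hn⟩ := clockwiseUnit_eq_iff.1 (mul_left_cancel₀ h0
      ((norm_mul_clockwiseUnit_angleParam (f t)).trans (hθ t)))
    have h3 : ⌊angleParam (f t)⌋ = 0 :=
      Int.floor_eq_zero_iff.2 ⟨angleParam_nonneg _, angleParam_lt_one _⟩
    rw [hn, crossingShift, Int.floor_add_intCast, h3, zero_add, add_comm, ← add_sub,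
      Int.floor_intCast_add]
  rw [h'.crossing_eq, (show IsAngle _ _ from hθ).crossing_eq]
  simp only [ContinuousMap.coe_mk, key]
  ring

end

end HawaiianPants

namespace HawaiianPants

noncomputable section

/-! ### Holonomy with values in the fundamental group -/

section Based

variable {X : Type*} [TopologicalSpace X]

/-- A continuous map on the unit interval as a path between its end points. -/
def pathOf (g : C(I, X)) : Path (g 0) (g 1) := ⟨g, rfl, rfl⟩

/-- The two ways around the boundary are homotopic in the simply connected square, and `K` carries
this homotopy to `X`. -/
theorem mk_pathOf_square (K : C(I × I, X)) :
    (Path.Homotopic.Quotient.mk (pathOf (K.comp (sliceLeft 0)))).trans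
        (Path.Homotopic.Quotient.mk (pathOf (K.comp (sliceRight 1)))) =
      Path.Homotopic.Quotient.trans (Path.Homotopic.Quotient.mk (pathOf (K.comp (sliceRight 0))))
        (Path.Homotopic.Quotient.mk (pathOf (K.comp (sliceLeft 1)))) := by
  let p₁ : Path ((0, 0) : I × I) (0, 1) := pathOf (sliceLeft 0)
  let p₂ : Path ((0, 1) : I × I) (1, 1) := pathOf (sliceRight 1)
  let p₃ : Path ((0, 0) : I × I) (1, 0) := pathOf (sliceRight 0)
  let p₄ : Path ((1, 0) : I × I) (1, 1) := pathOf (sliceLeft 1)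
  have h := (SimplyConnectedSpace.paths_homotopic (p₁.trans p₂) (p₃.trans p₄)).map K
  rw [Path.map_trans, Path.map_trans] at h
  exact Path.Homotopic.Quotient.eq.2 h

theorem conj_trans_conj {o x y z : X} (a : Path.Homotopic.Quotient o x)
    (p : Path.Homotopic.Quotient x y) (b : Path.Homotopic.Quotient o y)
    (q : Path.Homotopic.Quotient y z) (c : Path.Homotopic.Quotient z o) :
    ((a.trans p).trans b.symm).trans ((b.trans q).trans c) = (a.trans (p.trans q)).trans c := by
  simp only [Path.Homotopic.Quotient.trans_assoc]
  rw [← Path.Homotopic.Quotient.trans_assoc b.symm, Path.Homotopic.Quotient.symm_trans,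
    Path.Homotopic.Quotient.refl_trans]

/-- The holonomy with values in the fundamental group that is obtained from a choice of paths from
the base point to all points. -/
def basedHol {o : X} (a : ∀ x, Path o x) : Holonomy X (FundamentalGroup X o)ᵐᵒᵖ where
  hol g := MulOpposite.op (((Path.Homotopic.Quotient.mk (a (g 0))).trans
    (.mk (pathOf g))).trans (.mk (a (g 1)).symm))
  hol_const x := by
    apply MulOpposite.unop_injective
    change ((Path.Homotopic.Quotient.mk (a x)).trans (.mk (Path.refl x))).trans
      (.mk (a x).symm) = .refl o
    simp [Path.Homotopic.Quotient.mk_symm]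
  hol_square K := by
    apply MulOpposite.unop_injective
    rw [MulOpposite.unop_mul, MulOpposite.unop_mul, FundamentalGroup.mul_def,
      FundamentalGroup.mul_def]
    exact (conj_trans_conj (.mk (a (K (0, 0)))) (.mk (pathOf (K.comp (sliceLeft 0))))
      (.mk (a (K (0, 1)))) (.mk (pathOf (K.comp (sliceRight 1)))) (.mk (a (K (1, 1))).symm)).trans
      ((congrArg (fun q => (Path.Homotopic.Quotient.trans (.mk (a (K (0, 0)))) q).trans
        (.mk (a (K (1, 1))).symm)) (mk_pathOf_square K)).trans
      (conj_trans_conj (.mk (a (K (0, 0)))) (.mk (pathOf (K.comp (sliceRight 0))))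
      (.mk (a (K (1, 0)))) (.mk (pathOf (K.comp (sliceLeft 1)))) (.mk (a (K (1, 1))).symm)).symm)

theorem basedHol_path {o : X} (a : ∀ x, Path o x) {x y : X} (p : Path x y) :
    (basedHol a).hol p = MulOpposite.op (((Path.Homotopic.Quotient.mk (a x)).trans
      (.mk p)).trans (.mk (a y).symm)) := by
  obtain ⟨f, rfl, rfl⟩ := p
  rfl

/-- With a constant connecting path at the start and `p` itself at the end, the loop is `p` followed
by its reverse. -/
theorem basedHol_eq_one {o : X} (a : ∀ x, Path o x) {x y : X} (p : Path x y)
    (hx : ∀ s, a x s = o) (hy : ∀ s, a y s = p s) : (basedHol a).hol p = 1 := by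
  rw [basedHol_path]
  obtain rfl : o = x := by rw [← hx 1, (a x).target]
  have h1 : a o = Path.refl o := by ext s; exact hx s
  have h2 : a y = p := by ext s; exact hy s
  apply MulOpposite.unop_injective
  rw [h1, h2]
  change _ = Path.Homotopic.Quotient.refl o
  simp [Path.Homotopic.Quotient.mk_symm]

end Based

/-! ### Periodic holonomies on the real line -/

section Line

variable {Λ : Type*} [Group Λ]

/-- The affine path from `a` to `b` in the real line. -/
def affinePath (a b : ℝ) : C(I, ℝ) := ⟨fun t => a + t * (b - a), by fun_prop⟩

theorem affinePath_apply (a b : ℝ) (t : I) : affinePath a b t = a + t * (b - a) := rfl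

namespace Holonomy

variable (h : Holonomy ℝ Λ)

/-- The straight-line homotopy fixes the endpoints. -/
theorem hol_eq_affinePath (θ : C(I, ℝ)) : h.hol θ = h.hol (affinePath (θ 0) (θ 1)) := by
  let K : C(I × I, ℝ) :=
    ⟨fun p => (1 - p.1) * θ p.2 + p.1 * (θ 0 + p.2 * (θ 1 - θ 0)), by fun_prop⟩
  have := h.hol_eq_of_sides K (x := θ 0) (y := θ 1) (fun s => by simp [K]; ring)
    (fun s => by simp [K]; ring)
  convert this using 2 <;> ext t <;> simp [K, affinePath]

theorem affinePath_mul (a b c : ℝ) :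
    h.hol (affinePath a b) * h.hol (affinePath b c) = h.hol (affinePath a c) := by
  let K : C(I × I, ℝ) := ⟨fun p => a + p.2 * (b - a) + p.1 * p.2 * (c - b), by fun_prop⟩
  have := h.hol_square K
  have e : K.comp (sliceRight 0) = ContinuousMap.const I a := by ext t; simp [K]
  rw [e, h.hol_const, one_mul] at this
  convert this using 2
  · congr 1; ext t; simp [K, affinePath]
  · congr 1; ext t; simp [K, affinePath]
  · ext t; simp [K, affinePath]; ring

theorem affinePath_self (a : ℝ) : h.hol (affinePath a a) = 1 := by
  have e : affinePath a a = ContinuousMap.const I a := by ext t; simp [affinePath]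
  rw [e, h.hol_const]

/-- The holonomy of a path in the line, for a periodic holonomy that vanishes on a fundamental
domain. -/
theorem hol_eq_zpow (hper : ∀ a b, h.hol (affinePath (a + 1) (b + 1)) = h.hol (affinePath a b))
    (hone : ∀ t, 0 < t → t < 1 → h.hol (affinePath 0 t) = 1) (θ : C(I, ℝ)) :
    h.hol θ = h.hol (affinePath 0 1) ^ (⌊θ 1⌋ - ⌊θ 0⌋) := by
  have hper' (a b : ℝ) (n : ℤ) : h.hol (affinePath (a + n) (b + n)) = h.hol (affinePath a b) := by
    induction n using Int.induction_on with
    | zero => simp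
    | succ n ih => push_cast; rw [← add_assoc, ← add_assoc, hper]; exact_mod_cast ih
    | pred n ih =>
      rw [← ih, ← hper]
      congr 2 <;> (push_cast; ring)
  -- Moving from a point down to its floor costs nothing, so only the integer part of the
  -- displacement contributes.
  have h1 (x : ℝ) : h.hol (affinePath (⌊x⌋ : ℝ) x) = 1 := by
    have := hper' 0 (Int.fract x) ⌊x⌋
    rw [zero_add, Int.fract_add_floor] at this
    rw [this]
    rcases (Int.fract_nonneg x).eq_or_lt with h0 | h0
    · rw [← h0, affinePath_self]
    · exact hone _ h0 (Int.fract_lt_one x)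
  have h2 (n : ℤ) : h.hol (affinePath 0 n) = h.hol (affinePath 0 1) ^ n := by
    have hs (m : ℝ) : h.hol (affinePath 0 (m + 1)) =
        h.hol (affinePath 0 1) * h.hol (affinePath 0 m) := by
      rw [← h.affinePath_mul 0 1 (m + 1)]
      have := hper 0 m
      rw [zero_add] at this
      rw [this]
    induction n using Int.induction_on with
    | zero => simp [affinePath_self]
    | succ n ih => push_cast; rw [hs, add_comm (n : ℤ), zpow_one_add]; congr 1
    | pred n ih =>
      have := hs ((-(n : ℤ) - 1 : ℤ) : ℝ)
      rw [show (((-(n : ℤ) - 1 : ℤ) : ℝ) + 1) = ((-(n : ℤ) : ℤ) : ℝ) by push_cast; ring, ih] at this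
      rw [sub_eq_add_neg, add_comm, zpow_add, zpow_neg_one, this]
      push_cast
      rw [inv_mul_cancel_left, add_comm]
      rfl
  rw [hol_eq_affinePath, ← h.affinePath_mul (θ 0) (⌊θ 0⌋ : ℝ), ← h.affinePath_mul _ (⌊θ 1⌋ : ℝ) (θ 1),
    h1, mul_one, sub_eq_neg_add, zpow_add, zpow_neg, eq_inv_mul_iff_mul_eq]
  have h3 := h.affinePath_mul (⌊θ 0⌋ : ℝ) (θ 0) (⌊θ 0⌋ : ℝ)
  rw [h1, one_mul, affinePath_self] at h3
  have h4 := h.affinePath_mul 0 (⌊θ 0⌋ : ℝ) (⌊θ 1⌋ : ℝ)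
  rw [h3, one_mul]
  rwa [h2, h2] at h4

end Holonomy

end Line

end

end HawaiianPants

namespace HawaiianPants

noncomputable section

/-! ### Infinite concatenation of paths -/

section Concatenation

open Filter Topology

variable {Y : Type*} [TopologicalSpace Y] {y : ℕ → Y}

/-- The concatenation of infinitely many paths, parametrized by the real line. -/
def concatReal (p : ∀ n, Path (y n) (y (n + 1))) (u : ℝ) : Y := (p ⌊u⌋₊).extend (u - ⌊u⌋₊)

theorem concatReal_of_floor (p : ∀ n, Path (y n) (y (n + 1))) {u : ℝ} {n : ℕ} (h : ⌊u⌋₊ = n) :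
    concatReal p u = (p n).extend (u - n) := by subst h; rfl

theorem concatReal_eqOn (p : ∀ n, Path (y n) (y (n + 1))) (n : ℕ) :
    Set.EqOn (concatReal p) (fun u => (p n).extend (u - n)) (Set.Icc n (n + 1)) := by
  intro u hu
  rcases hu.2.eq_or_lt with h | h
  · have : ⌊u⌋₊ = n + 1 := by rw [h]; exact_mod_cast Nat.floor_natCast (n + 1)
    rw [concatReal_of_floor p this, h]
    simp
  · have : ⌊u⌋₊ = n := (Nat.floor_eq_iff (n.cast_nonneg.trans hu.1)).2 ⟨hu.1, h⟩
    exact concatReal_of_floor p this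

theorem continuous_concatReal (p : ∀ n, Path (y n) (y (n + 1))) : Continuous (concatReal p) := by
  have h (n : ℕ) : ContinuousOn (concatReal p) (Set.Iic n) := by
    induction n with
    | zero =>
      have : Set.EqOn (concatReal p) (fun _ => y 0) (Set.Iic ((0 : ℕ) : ℝ)) := by
        intro u hu
        have hu : u ≤ 0 := by simpa using hu
        have h0 : ⌊u⌋₊ = 0 := Nat.floor_of_nonpos hu
        rw [concatReal_of_floor p h0]
        exact (p 0).extend_of_le_zero (by simpa using hu)
      exact continuousOn_const.congr this
    | succ n ih =>
      have e : Set.Iic ((n + 1 : ℕ) : ℝ) = Set.Iic (n : ℝ) ∪ Set.Icc (n : ℝ) (n + 1) := by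
        rw [Set.Iic_union_Icc_eq_Iic (by linarith)]; push_cast; rfl
      rw [e]
      refine ih.union_of_isClosed ?_ isClosed_Iic isClosed_Icc
      refine ContinuousOn.congr ?_ (concatReal_eqOn p n)
      exact ((p n).continuous_extend.comp (by fun_prop)).continuousOn
  rw [continuous_iff_continuousAt]
  intro u
  obtain ⟨n, hn⟩ := exists_nat_gt u
  exact (h n).continuousAt (Iic_mem_nhds hn)

/-- A sequence of paths that converges to a point can be concatenated. -/
theorem joined_of_tendsto (p : ∀ n, Path (y n) (y (n + 1))) {y' : Y}
    (h : ∀ N ∈ 𝓝 y', ∀ᶠ n in atTop, Set.range (p n) ⊆ N) : Joined (y 0) y' := by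
  classical
  -- The substitution `s / (1 - s)` compresses the half-line into `[0, 1)`; the limit point fills in
  -- the end.
  let f : I → Y := fun s => if (s : ℝ) < 1 then concatReal p (s / (1 - s)) else y'
  have hf : Continuous f := by
    rw [continuous_iff_continuousAt]
    intro s
    rcases s.2.2.lt_or_eq with hs | hs
    · have h1 : f =ᶠ[𝓝 s] fun s => concatReal p (s / (1 - s)) := by
        have : ∀ᶠ r : I in 𝓝 s, (r : ℝ) < 1 :=
          continuous_subtype_val.continuousAt.eventually_lt continuousAt_const hs
        filter_upwards [this] with r hr using if_pos hr
      refine ContinuousAt.congr ?_ h1.symm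
      refine (continuous_concatReal p).continuousAt.comp ?_
      exact ContinuousAt.div (by fun_prop) (by fun_prop) (by linarith)
    · have hs1 : s = 1 := Subtype.ext hs
      subst hs1
      intro N hN
      have hN' : N ∈ 𝓝 y' := by simpa [f] using hN
      obtain ⟨k, hk⟩ := eventually_atTop.1 (h N hN')
      -- Past `k / (k + 1)` the reparametrized time is at least `k`, so only paths lying in `N` are
      -- traversed.
      have h2 : ∀ᶠ r : I in 𝓝 1, (k : ℝ) / (k + 1) ≤ r := by
        have : (k : ℝ) / (k + 1) < ((1 : I) : ℝ) := by
          rw [Set.Icc.coe_one, div_lt_one (by positivity)]; linarith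
        filter_upwards [(continuousAt_const (y := (k : ℝ) / (k + 1))).eventually_lt
          (continuous_subtype_val.continuousAt (x := (1 : I))) this] with r hr using hr.le
      change ∀ᶠ r in 𝓝 1, f r ∈ N
      filter_upwards [h2] with r hr
      by_cases h1 : (r : ℝ) < 1
      · simp only [f, if_pos h1, concatReal]
        have h3 : (k : ℝ) ≤ r / (1 - r) := by
          rw [div_le_iff₀ (by positivity)] at hr
          rw [le_div_iff₀ (by linarith)]
          linarith
        have h4 := hk _ (Nat.le_floor h3)
        refine h4 ?_
        rw [← Path.extend_range]
        exact Set.mem_range_self _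
      · simp only [f, if_neg h1]
        exact mem_of_mem_nhds hN'
  exact ⟨⟨⟨f, hf⟩, by simp [f, concatReal], by simp [f]⟩⟩

end Concatenation

/-! ### Free homotopies as paths in the space of free loops -/

section FreeLoops

variable {X Z : Type*} [TopologicalSpace X] [TopologicalSpace Z]

/-- The space of free loops in `X`. -/
abbrev FreeLoop (X : Type*) [TopologicalSpace X] : Type _ := {f : C(I, X) // f 0 = f 1}

/-- A loop as a free loop. -/
def freeLoop {x : X} (p : Path x x) : FreeLoop X := ⟨p, p.source.trans p.target.symm⟩

/-- The constant free loop. -/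
def constLoop (x : X) : FreeLoop X := ⟨ContinuousMap.const I x, rfl⟩

/-- The composition of a free loop with a continuous map. -/
def FreeLoop.map (f : C(X, Z)) (l : FreeLoop X) : FreeLoop Z :=
  ⟨f.comp l.1, congrArg f l.2⟩

/-- A free loop as a path. -/
def FreeLoop.toPath (l : FreeLoop X) : Path (l.1 0) (l.1 0) := ⟨l.1, rfl, l.2.symm⟩

theorem joined_iff_exists {l l' : FreeLoop X} : Joined l l' ↔ ∃ F : C(I × I, X),
    (∀ t, F (0, t) = l.1 t) ∧ (∀ t, F (1, t) = l'.1 t) ∧ ∀ s, F (s, 0) = F (s, 1) := by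
  constructor
  · rintro ⟨p⟩
    refine ⟨ContinuousMap.uncurry ⟨fun s => (p s).1, by fun_prop⟩, fun t => ?_, fun t => ?_,
      fun s => (p s).2⟩
    · exact congrArg (fun l : FreeLoop X => l.1 t) p.source
    · exact congrArg (fun l : FreeLoop X => l.1 t) p.target
  · rintro ⟨F, h0, h1, h⟩
    refine ⟨⟨⟨fun s => ⟨F.curry s, h s⟩, by fun_prop⟩, ?_, ?_⟩⟩
    · ext t; exact h0 t
    · ext t; exact h1 t

theorem joined_map {l l' : FreeLoop X} (f : C(X, Z)) (h : Joined l l') :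
    Joined (l.map f) (l'.map f) := by
  obtain ⟨F, h0, h1, h⟩ := joined_iff_exists.1 h
  exact joined_iff_exists.2 ⟨f.comp F, fun t => congrArg f (h0 t), fun t => congrArg f (h1 t),
    fun s => congrArg f (h s)⟩

theorem freelyHomotopic_iff {x y : X} {p : Path x x} {q : Path y y} :
    p.FreelyHomotopic q ↔ Joined (freeLoop p) (freeLoop q) := by
  rw [joined_iff_exists]
  constructor
  · rintro ⟨F⟩
    exact ⟨F.toContinuousMap, F.apply_zero, F.apply_one, F.prop⟩
  · rintro ⟨F, h0, h1, h⟩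
    exact ⟨⟨⟨F, h0, h1⟩, h⟩⟩

theorem mk_square (F : C(I × I, X)) {x y z w : X} (a : Path x y) (b : Path y w) (c : Path x z)
    (d : Path z w) (ha : ∀ t, F (0, t) = a t) (hb : ∀ s, F (s, 1) = b s)
    (hc : ∀ s, F (s, 0) = c s) (hd : ∀ t, F (1, t) = d t) :
    (Path.Homotopic.Quotient.mk a).trans (.mk b) =
      (Path.Homotopic.Quotient.mk c).trans (.mk d) := by
  obtain rfl : F (0, 0) = x := (ha 0).trans a.source
  obtain rfl : F (0, 1) = y := (ha 1).trans a.target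
  obtain rfl : F (1, 0) = z := (hc 1).trans c.target
  obtain rfl : F (1, 1) = w := (hd 1).trans d.target
  obtain rfl : pathOf (F.comp (sliceLeft 0)) = a := Path.ext (funext ha)
  obtain rfl : pathOf (F.comp (sliceRight 1)) = b := Path.ext (funext hb)
  obtain rfl : pathOf (F.comp (sliceRight 0)) = c := Path.ext (funext hc)
  obtain rfl : pathOf (F.comp (sliceLeft 1)) = d := Path.ext (funext hd)
  exact mk_pathOf_square F

/-- The track `c` of the base point gives the relation `p · c ≃ c · 1`, and `c` cancels. -/
theorem homotopic_refl_of_joined_const {x y : X} {p : Path x x}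
    (h : Joined (freeLoop p) (constLoop y)) : p.Homotopic (Path.refl x) := by
  obtain ⟨F, h0, h1, h⟩ := joined_iff_exists.1 h
  let c : Path x y := ⟨F.comp (sliceRight 0), (h0 0).trans p.source, h1 0⟩
  have hsq := mk_square F p c c (Path.refl y) h0 (fun s => (h s).symm) (fun s => rfl) h1
  rw [← Path.Homotopic.Quotient.eq, ← Path.Homotopic.Quotient.trans_refl (.mk p),
    ← Path.Homotopic.Quotient.trans_symm (.mk c), ← Path.Homotopic.Quotient.trans_assoc, hsq]
  simp

theorem joined_of_homotopic {x : X} {p q : Path x x} (h : p.Homotopic q) :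
    Joined (freeLoop p) (freeLoop q) := by
  obtain ⟨F⟩ := h
  exact joined_iff_exists.2 ⟨F.toContinuousMap, F.apply_zero, F.apply_one, fun s => by
    exact (F.source s).trans (F.target s).symm⟩

/-- Shorten the tail `c` at time `s` to its part over `[s, 1]`. -/
theorem joined_conj {x y : X} (c : Path x y) (q : Path y y) :
    Joined (freeLoop ((c.trans q).trans c.symm)) (freeLoop q) := by
  let d (s : I) : Path (c s) y :=
    ⟨⟨fun t => c (Set.Icc.convexComb s 1 t), by fun_prop⟩, by simp, by simp⟩
  have hd : Continuous ↿d := by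
    refine c.continuous.comp (Set.Icc.continuous_convexComb_prod.comp
      (continuous_fst.prodMk (continuous_const.prodMk continuous_snd)))
  have hF := Path.trans_continuous_family _
    (Path.trans_continuous_family d hd (fun _ => q) (q.continuous.comp continuous_snd)) _
    (Path.symm_continuous_family d hd)
  have h0 : d 0 = c.cast c.source rfl := by ext t; simp [d]
  have h1 : d 1 = (Path.refl y).cast c.target rfl := by ext t; simp [d]
  refine (joined_iff_exists.2 ⟨⟨_, hF⟩, fun t => ?_, fun t => ?_, fun s => ?_⟩ :
    Joined _ (freeLoop (((Path.refl y).trans q).trans (Path.refl y).symm))).trans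
    (joined_of_homotopic ?_)
  · change (((d 0).trans q).trans (d 0).symm) t = ((c.trans q).trans c.symm) t
    rw [h0]; rfl
  · change (((d 1).trans q).trans (d 1).symm) t = _
    rw [h1]; rfl
  · change (((d s).trans q).trans (d s).symm) 0 = (((d s).trans q).trans (d s).symm) 1
    rw [Path.source, Path.target]
  · rw [← Path.Homotopic.Quotient.eq]
    simp [Path.Homotopic.Quotient.mk_trans]

end FreeLoops

end

end HawaiianPants

namespace HawaiianPants

noncomputable section

/-! ### From holonomy back to free homotopy -/

section BasedLoops

variable {X : Type*} [TopologicalSpace X] {o : X} (a : ∀ x, Path o x)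

theorem joined_conj_base (l : FreeLoop X) :
    ∃ p : Path o o, Joined l (freeLoop p) ∧ (basedHol a).hol l.1 = MulOpposite.op (.mk p) := by
  refine ⟨((a (l.1 0)).trans l.toPath).trans (a (l.1 0)).symm,
    (joined_conj (a (l.1 0)) l.toPath).symm, ?_⟩
  exact basedHol_path a l.toPath

theorem joined_const_of_basedHol_eq_one {l : FreeLoop X} (h : (basedHol a).hol l.1 = 1) :
    Joined l (constLoop o) := by
  obtain ⟨p, hp, hl⟩ := joined_conj_base a l
  rw [hl] at h
  have h1 : Path.Homotopic.Quotient.mk p = .mk (Path.refl o) := congrArg MulOpposite.unop h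
  exact hp.trans (joined_of_homotopic (Path.Homotopic.Quotient.eq.1 h1))

/-- A path representing `g` conjugates one based representative into the other, and conjugation does
not change the free homotopy class. -/
theorem joined_of_basedHol_conj {l l' : FreeLoop X} {g : (FundamentalGroup X o)ᵐᵒᵖ}
    (h : g * (basedHol a).hol l.1 = (basedHol a).hol l'.1 * g) : Joined l l' := by
  obtain ⟨p, hp, hl⟩ := joined_conj_base a l
  obtain ⟨p', hp', hl'⟩ := joined_conj_base a l'
  rw [hl, hl'] at h
  obtain ⟨c, hc⟩ := Path.Homotopic.Quotient.mk_surjective g.unop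
  have h1 : (Path.Homotopic.Quotient.mk c).trans (.mk p) =
      (Path.Homotopic.Quotient.mk p').trans (.mk c) := by
    rw [hc]; exact congrArg MulOpposite.unop h
  have h2 : Path.Homotopic ((c.trans p).trans c.symm) p' := by
    rw [← Path.Homotopic.Quotient.eq, Path.Homotopic.Quotient.mk_trans,
      Path.Homotopic.Quotient.mk_trans, h1, Path.Homotopic.Quotient.mk_symm,
      Path.Homotopic.Quotient.trans_assoc, Path.Homotopic.Quotient.trans_symm,
      Path.Homotopic.Quotient.trans_refl]
  exact hp.trans ((joined_conj c p).symm.trans ((joined_of_homotopic h2).trans hp'.symm))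

end BasedLoops

/-! ### The earring, its circles and their holonomy -/

section Earring

/-- Squaring the equation of the circle shows that, off the origin, the index is `2 Re z / ‖z‖²`,
hence a continuous function of the point. -/
theorem mem_earringCircle_iff {n : ℕ+} {z : ℂ} :
    z ∈ earringCircle n ↔ (n : ℝ) * ‖z‖ ^ 2 = 2 * z.re := by
  have hn : (0 : ℝ) < n := by exact_mod_cast n.pos
  rw [earringCircle, mem_sphere_iff_norm, ← sq_eq_sq₀ (norm_nonneg _) (by positivity),
    ← Complex.normSq_eq_norm_sq, ← Complex.normSq_eq_norm_sq, Complex.normSq_apply,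
    Complex.normSq_apply]
  have h1 : (1 / (n : ℂ)) = ((1 / (n : ℝ) : ℝ) : ℂ) := by push_cast; rfl
  rw [h1, Complex.sub_re, Complex.sub_im, Complex.ofReal_re, Complex.ofReal_im]
  constructor
  · intro h
    field_simp at h
    nlinarith
  · intro h
    field_simp
    nlinarith

/-- The origin as a point of the earring. -/
def origin : earring := ⟨0, Set.mem_iUnion.2 ⟨1, mem_earringCircle_iff.2 (by simp)⟩⟩

/-- The points of the earring on one of the circles with index in `A`, other than the origin. -/
def petals (A : Set ℕ+) : Set ℂ := {z | z ≠ 0 ∧ ∃ n ∈ A, z ∈ earringCircle n}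

theorem index_unique {m n : ℕ+} {z : ℂ} (hz : z ≠ 0) (hm : z ∈ earringCircle m)
    (hn : z ∈ earringCircle n) : m = n := by
  rw [mem_earringCircle_iff] at hm hn
  have h0 : ‖z‖ ^ 2 ≠ 0 := by positivity
  have := mul_right_cancel₀ h0 (hm.trans hn.symm)
  exact_mod_cast this

/-- The index is continuous and integer-valued off the origin, so lying strictly between `n - 1` and
`n + 1` pins it down. -/
theorem isOpen_petals (A : Set ℕ+) : IsOpen {z : earring | (z : ℂ) ∈ petals A} := by
  have h : {z : earring | (z : ℂ) ∈ petals A} = ⋃ n ∈ A, {z : earring | (z : ℂ) ≠ 0 ∧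
      ((n : ℝ) - 1) * ‖(z : ℂ)‖ ^ 2 < 2 * (z : ℂ).re ∧
      2 * (z : ℂ).re < ((n : ℝ) + 1) * ‖(z : ℂ)‖ ^ 2} := by
    ext z
    simp only [Set.mem_iUnion, Set.mem_ofPred_eq, exists_prop, petals]
    constructor
    · rintro ⟨h0, n, hn, hz⟩
      rw [mem_earringCircle_iff] at hz
      have : 0 < ‖(z : ℂ)‖ ^ 2 := by positivity
      exact ⟨n, hn, h0, by linarith, by linarith⟩
    · rintro ⟨n, hn, h0, h1, h2⟩
      refine ⟨h0, n, hn, ?_⟩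
      obtain ⟨m, hm⟩ := Set.mem_iUnion.1 z.2
      have hm' := mem_earringCircle_iff.1 hm
      have h3 : 0 < ‖(z : ℂ)‖ ^ 2 := by positivity
      rw [← hm'] at h1 h2
      have h4 := lt_of_mul_lt_mul_right h1 h3.le
      have h5 := lt_of_mul_lt_mul_right h2 h3.le
      have h6 : (n : ℤ) - 1 < m := by exact_mod_cast h4
      have h7 : (m : ℤ) < n + 1 := by exact_mod_cast h5
      have : (m : ℤ) = n := by omega
      rwa [show n = m from PNat.coe_injective (by exact_mod_cast this.symm)]
  rw [h]
  refine isOpen_biUnion fun n _ => ?_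
  simp only [Set.ofPred_and]
  exact (isOpen_ne_fun (by fun_prop) (by fun_prop)).inter
    ((isOpen_lt (by fun_prop) (by fun_prop)).inter (isOpen_lt (by fun_prop) (by fun_prop)))

theorem petals_or (A : Set ℕ+) (z : earring) :
    z = origin ∨ (z : ℂ) ∈ petals A ∨ (z : ℂ) ∈ petals Aᶜ := by
  obtain ⟨m, hm⟩ := Set.mem_iUnion.1 z.2
  by_cases h0 : (z : ℂ) = 0
  · exact Or.inl (Subtype.ext h0)
  · by_cases hA : m ∈ A
    · exact Or.inr (Or.inl ⟨h0, m, hA, hm⟩)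
    · exact Or.inr (Or.inr ⟨h0, m, hA, hm⟩)

theorem notMem_petals_compl {A : Set ℕ+} {z : ℂ} (h : z ∈ petals A) : z ∉ petals Aᶜ := by
  rintro ⟨h0, m, hm, hz⟩
  obtain ⟨-, n, hn, hz'⟩ := h
  exact hm (index_unique h0 hz hz' ▸ hn)

open Classical in
/-- Piecewise definition of continuous functions by the index of the circle of the earring. -/
theorem continuousAt_ite_petals {Z : Type*} [TopologicalSpace Z] {A : Set ℕ+} {p : Z → earring}
    {z : Z} (hp : ContinuousAt p z) {f g : Z → ℂ}
    (hf : (p z : ℂ) ∈ petals A → ContinuousAt f z) (hg : (p z : ℂ) ∈ petals Aᶜ → ContinuousAt g z)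
    (h0 : p z = origin → ContinuousAt f z ∧ ContinuousAt g z ∧ f z = g z) :
    ContinuousAt (fun z => if (p z : ℂ) ∈ petals A then f z else g z) z := by
  rcases petals_or A (p z) with h | h | h
  · obtain ⟨h1, h2, h3⟩ := h0 h
    have h4 : (p z : ℂ) ∉ petals A := fun h' => h'.1 (congrArg Subtype.val h)
    rw [ContinuousAt, if_neg h4]
    exact Filter.Tendsto.if' (h3 ▸ h1) h2
  · refine (hf h).congr ?_
    filter_upwards [hp ((isOpen_petals A).mem_nhds h)] with y hy
    exact (if_pos hy).symm
  · refine (hg h).congr ?_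
    filter_upwards [hp ((isOpen_petals Aᶜ).mem_nhds h)] with y hy
    rw [if_neg]
    exact fun h' => notMem_petals_compl h' hy

/-- The parametrization of the circles of the earring by the real line. -/
def earringCurve (n : ℕ+) : C(ℝ, earring) where
  toFun θ := ⟨(1 + clockwiseUnit θ) / n, Set.mem_iUnion.2 ⟨n, by
    have hn : (n : ℂ) ≠ 0 := by exact_mod_cast n.ne_zero
    rw [earringCircle, mem_sphere_iff_norm, add_div, add_sub_cancel_left, norm_div,
      norm_clockwiseUnit]
    simp⟩⟩
  continuous_toFun := by
    have := continuous_clockwiseUnit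
    fun_prop

theorem earringCurve_coe (n : ℕ+) (θ : ℝ) :
    (earringCurve n θ : ℂ) = (1 + clockwiseUnit θ) / n := rfl

theorem earringLoop_eq (n : ℕ+) (t : I) : earringLoop n t = earringCurve n t := by
  ext1
  change clockwise _ _ t = _
  rw [earringCurve_coe, clockwise, clockwiseUnit]
  push_cast
  ring

theorem earringCurve_mem (n : ℕ+) (θ : ℝ) : (earringCurve n θ : ℂ) ∈ earringCircle n := by
  have hn : (n : ℂ) ≠ 0 := by exact_mod_cast n.ne_zero
  rw [earringCircle, mem_sphere_iff_norm, earringCurve_coe, add_div, add_sub_cancel_left, norm_div,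
    norm_clockwiseUnit]
  simp

theorem clockwiseUnit_zero : clockwiseUnit 0 = -1 := by simp [clockwiseUnit]

theorem earringCurve_eq_iff {n : ℕ+} {θ θ' : ℝ} :
    earringCurve n θ = earringCurve n θ' ↔ ∃ k : ℤ, θ' = θ + k := by
  have hn : (n : ℂ) ≠ 0 := by exact_mod_cast n.ne_zero
  rw [← clockwiseUnit_eq_iff, Subtype.ext_iff, earringCurve_coe, earringCurve_coe]
  constructor
  · intro h
    exact add_left_cancel ((div_left_inj' hn).1 h)
  · intro h; rw [h]

theorem earringCurve_zero (n : ℕ+) : earringCurve n 0 = origin := by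
  ext1; simp [earringCurve_coe, clockwiseUnit_zero, origin]

theorem exists_earringCurve_eq (z : earring) :
    ∃ (n : ℕ+) (t : ℝ), 0 ≤ t ∧ t < 1 ∧ earringCurve n t = z := by
  obtain ⟨n, hn⟩ := Set.mem_iUnion.1 z.2
  have hn0 : (n : ℂ) ≠ 0 := by exact_mod_cast n.ne_zero
  refine ⟨n, angleParam (n * z - 1), angleParam_nonneg _, angleParam_lt_one _, ?_⟩
  have h1 : ‖(n * z - 1 : ℂ)‖ = 1 := by
    rw [earringCircle, mem_sphere_iff_norm] at hn
    rw [show (n * z - 1 : ℂ) = n * (z - 1 / n) by field_simp, norm_mul, hn]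
    have : ‖(n : ℂ)‖ = n := by simp
    rw [this]
    have : (n : ℝ) ≠ 0 := by exact_mod_cast n.ne_zero
    field_simp
  have h2 := norm_mul_clockwiseUnit_angleParam (n * z - 1)
  rw [h1, Complex.ofReal_one, one_mul] at h2
  ext1
  rw [earringCurve_coe, h2]
  field_simp
  ring

/-- An arc from the origin to a point of the earring. -/
def arc (z : earring) : Path origin z where
  toFun s := earringCurve (exists_earringCurve_eq z).choose
    (s * (exists_earringCurve_eq z).choose_spec.choose)
  source' := by simp [earringCurve_zero]
  target' := by simpa using (exists_earringCurve_eq z).choose_spec.choose_spec.2.2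

/-- The choices made in `arc` are immaterial: off the origin the circle and the parameter in `[0,
1)` are unique, and at the origin the parameter is `0`. -/
theorem arc_apply {n : ℕ+} {t : ℝ} (h0 : 0 ≤ t) (h1 : t < 1) {z : earring}
    (hz : earringCurve n t = z) (s : I) : arc z s = earringCurve n (s * t) := by
  change earringCurve _ (s * (exists_earringCurve_eq z).choose_spec.choose) = _
  generalize_proofs h2 h3
  obtain ⟨h4, h5, h6⟩ := h3.choose_spec
  generalize h2.choose = m at *
  generalize h3.choose = r at *
  have key {k : ℤ} {a b : ℝ} (ha0 : 0 ≤ a) (ha : a < 1) (hb0 : 0 ≤ b) (hb : b < 1)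
      (h : b = a + k) : a = b := by
    have h7 : (-1 : ℝ) < k := by linarith
    have h8 : (k : ℝ) < 1 := by linarith
    have h9 : -1 < k := by exact_mod_cast h7
    have h10 : k < 1 := by exact_mod_cast h8
    have : k = 0 := by omega
    subst this; simpa using h.symm
  by_cases hz0 : z = origin
  · obtain ⟨k, hk⟩ := earringCurve_eq_iff.1 ((earringCurve_zero n).trans (hz0.symm.trans hz.symm))
    obtain ⟨k', hk'⟩ :=
      earringCurve_eq_iff.1 ((earringCurve_zero m).trans (hz0.symm.trans h6.symm))
    rw [← key le_rfl one_pos h0 h1 hk, ← key le_rfl one_pos h4 h5 hk', mul_zero,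
      earringCurve_zero, earringCurve_zero]
  · have hmn : m = n := index_unique (z := z) (fun h => hz0 (Subtype.ext h))
      (h6 ▸ earringCurve_mem m r) (hz ▸ earringCurve_mem n t)
    subst hmn
    obtain ⟨k, hk⟩ := earringCurve_eq_iff.1 (h6.trans hz.symm)
    rw [key h4 h5 h0 h1 hk]

/-- The fundamental group of the earring, with multiplication in the order of concatenation. -/
abbrev EarringGroup : Type := (FundamentalGroup earring origin)ᵐᵒᵖ

/-- The holonomy of the earring with values in its fundamental group. -/
def earringHol : Holonomy earring EarringGroup := basedHol arc

/-- The class of a circle of the earring. -/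
def circleClass (n : ℕ+) : EarringGroup := (earringHol.pullback (earringCurve n)).hol (affinePath 0 1)

/-- Within `[0, 1)` the connecting arcs run along the circle itself, so the holonomy from `0` is
trivial there and only passages through the origin count. -/
theorem earringHol_curve (n : ℕ+) (θ : C(I, ℝ)) :
    earringHol.hol ((earringCurve n).comp θ) = circleClass n ^ (⌊θ 1⌋ - ⌊θ 0⌋) := by
  refine (earringHol.pullback (earringCurve n)).hol_eq_zpow (fun a b => ?_) (fun t h0 h1 => ?_) θ
  · change earringHol.hol _ = earringHol.hol _
    congr 1
    ext1 s
    refine earringCurve_eq_iff.2 ⟨-1, ?_⟩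
    simp [affinePath_apply]; ring
  · refine basedHol_eq_one arc (x := earringCurve n 0) (y := earringCurve n t)
      ⟨(earringCurve n).comp (affinePath 0 t), by simp [affinePath_apply],
        by simp [affinePath_apply]⟩ (fun s => ?_) (fun s => ?_)
    · rw [arc_apply le_rfl one_pos rfl, mul_zero, earringCurve_zero]
    · rw [arc_apply h0.le h1 rfl]
      change _ = earringCurve n (0 + s * (t - 0))
      simp

end Earring

end

end HawaiianPants

namespace HawaiianPants

noncomputable section

/-! ### Retractions, winding numbers and the representation on the earring -/

open Classical in
/-- The retraction of the earring onto the union of the circles with index in `A`. -/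
def retract (A : Set ℕ+) : C(earring, earring) where
  toFun z := ⟨if (z : ℂ) ∈ petals A then z else 0, by
    split_ifs
    · exact z.2
    · exact origin.2⟩
  continuous_toFun := by
    refine Continuous.subtype_mk (continuous_iff_continuousAt.2 fun z => ?_) _
    exact continuousAt_ite_petals (p := id) (f := fun z : earring => (z : ℂ)) (g := fun _ => 0)
      continuousAt_id (fun _ => by fun_prop) (fun _ => by fun_prop)
      fun h => ⟨by fun_prop, by fun_prop, congrArg Subtype.val h⟩

theorem retract_of_mem {A : Set ℕ+} {z : earring} (h : (z : ℂ) ∈ petals A) : retract A z = z :=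
  Subtype.ext (if_pos h)

theorem retract_of_notMem {A : Set ℕ+} {z : earring} (h : (z : ℂ) ∉ petals A) :
    retract A z = origin := Subtype.ext (if_neg h)

theorem retract_eq_or (A : Set ℕ+) (z : earring) :
    retract A z = origin ∨ ((retract A z : earring) : ℂ) ∈ petals A := by
  by_cases h : (z : ℂ) ∈ petals A
  · right; rwa [retract_of_mem h]
  · left; exact retract_of_notMem h

theorem retract_eq_self {A : Set ℕ+} {z : earring} (h : z = origin ∨ (z : ℂ) ∈ petals A) :
    retract A z = z := by
  rcases h with rfl | h
  · exact retract_of_notMem fun h => h.1 rfl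
  · exact retract_of_mem h

theorem norm_le_of_mem_petals {k : ℕ+} {z : ℂ} (h : z ∈ petals {m | k < m}) : ‖z‖ ≤ 2 / k := by
  obtain ⟨h0, m, hm, hz⟩ := h
  rw [mem_earringCircle_iff] at hz
  have hk : (0 : ℝ) < k := by exact_mod_cast k.pos
  have hmk : (k : ℝ) ≤ m := by exact_mod_cast (show k < m from hm).le
  have h1 : 0 < ‖z‖ := norm_pos_iff.2 h0
  have h2 := z.re_le_norm
  rw [le_div_iff₀ hk]
  have h3 : ‖z‖ * (m * ‖z‖) ≤ ‖z‖ * 2 := by nlinarith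
  have h4 := le_of_mul_le_mul_left h3 h1
  nlinarith

/-- The map from the earring to the punctured plane that maps the circle with index `n` to the
unit circle and the other ones to a point. -/
def circleMap (n : ℕ+) : C(earring, PuncturedPlane) where
  toFun z := ⟨n * (retract {n} z : earring) - 1, by
    have hn : (n : ℝ) ≠ 0 := by exact_mod_cast n.ne_zero
    rcases retract_eq_or {n} z with h | h
    · rw [h]; simp [origin]
    · obtain ⟨-, m, rfl, hz⟩ := h
      rw [mem_earringCircle_iff] at hz
      -- A zero would place the center of the circle on the circle.
      intro h
      have h1 : ((retract {m} z : earring) : ℂ) = ((1 / m : ℝ) : ℂ) := by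
        push_cast
        field_simp
        linear_combination h
      rw [h1, Complex.norm_real, Complex.ofReal_re, Real.norm_eq_abs, sq_abs] at hz
      field_simp at hz
      norm_num at hz⟩
  continuous_toFun := ((continuous_const.mul (continuous_subtype_val.comp
    (retract {n}).continuous)).sub continuous_const).subtype_mk _

theorem circleMap_curve_self (n : ℕ+) (θ : ℝ) :
    (circleMap n (earringCurve n θ) : ℂ) = clockwiseUnit θ := by
  have hn : (n : ℂ) ≠ 0 := by exact_mod_cast n.ne_zero
  change (n * (retract {n} (earringCurve n θ) : earring) - 1 : ℂ) = _
  rw [retract_eq_self, earringCurve_coe]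
  · field_simp; ring
  · by_cases h : earringCurve n θ = origin
    · exact Or.inl h
    · exact Or.inr ⟨fun h' => h (Subtype.ext h'), n, rfl, earringCurve_mem n θ⟩

theorem circleMap_curve_of_ne {m n : ℕ+} (hmn : m ≠ n) (θ : ℝ) :
    (circleMap m (earringCurve n θ) : ℂ) = -1 := by
  change (m * (retract {m} (earringCurve n θ) : earring) - 1 : ℂ) = _
  rw [retract_of_notMem]
  · simp [origin]
  · rintro ⟨h0, k, rfl, hk⟩
    exact hmn (index_unique h0 hk (earringCurve_mem n θ))

/-- The winding numbers around all circles, as a holonomy. -/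
def windingHol : Holonomy earring (Multiplicative (ℕ+ → ℤ)) :=
  (Holonomy.pi fun n => crossingHol.pullback (circleMap n)).map
    { toFun := fun f => Multiplicative.ofAdd fun n => (f n).toAdd
      map_one' := rfl
      map_mul' := fun _ _ => rfl }

/-- The parameter `θ` is an angle function for the map of circle `n`, and all other circle maps are
constant on that circle. -/
theorem windingHol_curve (n : ℕ+) (θ : C(I, ℝ)) :
    windingHol.hol ((earringCurve n).comp θ) =
      Multiplicative.ofAdd (Pi.single n (1 : ℤ)) ^ (⌊θ 1⌋ - ⌊θ 0⌋) := by
  rw [← ofAdd_zsmul]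
  refine congrArg Multiplicative.ofAdd (funext fun m => ?_)
  change crossing ((circleMap m).comp ((earringCurve n).comp θ)) = _
  by_cases h : m = n
  · subst h
    rw [IsAngle.crossing_eq (θ := θ)]
    · simp
    · intro t
      change ((circleMap m (earringCurve m (θ t)) : PuncturedPlane) : ℂ) =
        ‖((circleMap m (earringCurve m (θ t)) : PuncturedPlane) : ℂ)‖ * _
      rw [circleMap_curve_self, norm_clockwiseUnit]
      simp
  · have : (circleMap m).comp ((earringCurve n).comp θ) =
        ContinuousMap.const I (⟨-1, by simp⟩ : PuncturedPlane) := by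
      ext t
      exact circleMap_curve_of_ne h (θ t)
    rw [this]
    have h1 := crossingHol.hol_const (⟨-1, by simp⟩ : PuncturedPlane)
    have h2 : crossing (ContinuousMap.const I (⟨-1, by simp⟩ : PuncturedPlane)) = 0 :=
      congrArg Multiplicative.toAdd h1
    rw [h2]
    simp [h]

/-- The holonomy on the earring that is extended to the Hawaiian pants. -/
def earringRepHol : Holonomy earring (Rep EarringGroup ℕ+) :=
  (earringHol.prod windingHol).map earringRep

/-- The value of the representation on a circle of the earring. -/
def circleRep (n : ℕ+) : Rep EarringGroup ℕ+ :=
  earringRep (circleClass n, Multiplicative.ofAdd (Pi.single n 1))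

theorem earringRepHol_curve (n : ℕ+) (θ : C(I, ℝ)) :
    earringRepHol.hol ((earringCurve n).comp θ) = circleRep n ^ (⌊θ 1⌋ - ⌊θ 0⌋) := by
  change earringRep (earringHol.hol _, windingHol.hol _) = _
  rw [earringHol_curve, windingHol_curve]
  exact map_zpow earringRep (circleClass n, Multiplicative.ofAdd (Pi.single n 1)) _

theorem joined_of_earringRepHol_conj {l l' : FreeLoop earring} {c : Rep EarringGroup ℕ+}
    (h : earringRepHol.hol l.1 * c = c * earringRepHol.hol l'.1) :
    Joined l (constLoop origin) ∨ Joined l l' := by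
  rcases eq_one_or_conj_of_earringRep h with h | ⟨g, h⟩
  · exact Or.inl (joined_const_of_basedHol_eq_one arc h)
  · exact Or.inr (joined_of_basedHol_conj arc h)

/-! ### Sliding the large circles into the origin -/

section Contraction

/-- The only nonzero real point of circle `m` is `2 / m`, which is at least `2 / k` in size when `m
≤ k`. -/
theorem im_ne_zero {k : ℕ+} {z : ℂ} (hz : z ∈ petals {m | m ≤ k}) (h : ‖z‖ < 2 / k) :
    z.im ≠ 0 := by
  intro him
  obtain ⟨h0, m, hm, hzm⟩ := hz
  rw [mem_earringCircle_iff] at hzm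
  have hm' : (m : ℝ) ≤ k := by exact_mod_cast hm
  have hk : (0 : ℝ) < k := by exact_mod_cast k.pos
  have hr : ‖z‖ = |z.re| := by
    conv_lhs => rw [← Complex.re_add_im z, him]
    simp
  have h1 : 0 < ‖z‖ := norm_pos_iff.2 h0
  rw [lt_div_iff₀ hk] at h
  have h2 : 0 < m * ‖z‖ ^ 2 := by have := m.pos; positivity
  have h3 : 0 < z.re := by linarith
  rw [abs_of_pos h3] at hr
  rw [hr] at hzm h
  have : (m : ℝ) * z.re = 2 := by
    have : z.re * (m * z.re - 2) = 0 := by linear_combination hzm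
    rcases mul_eq_zero.1 this with h | h
    · exact absurd h h3.ne'
    · linarith
  nlinarith

/-- The contraction of the arcs of the earring near the origin, at time `1 - r`. -/
def slide (r : ℝ) (z : ℂ) : ℂ := ((r * ‖z‖ ^ 2 : ℝ) : ℂ) / ⟨r * z.re, -z.im⟩

theorem slide_one (z : ℂ) : slide 1 z = z := by
  rcases eq_or_ne z 0 with rfl | h
  · simp [slide]
  · have h1 : (⟨1 * z.re, -z.im⟩ : ℂ) = (starRingEnd ℂ) z := by
      apply Complex.ext <;> simp
    have h2 : (starRingEnd ℂ) z ≠ 0 := by simpa using h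
    rw [slide, h1, one_mul, div_eq_iff h2, Complex.mul_conj, Complex.normSq_eq_norm_sq]

theorem slide_zero (z : ℂ) : slide 0 z = 0 := by simp [slide]

theorem norm_slide_le {r : ℝ} (h0 : 0 ≤ r) (h1 : r ≤ 1) (z : ℂ) : ‖slide r z‖ ≤ ‖z‖ := by
  have h2 : r * ‖z‖ ≤ ‖(⟨r * z.re, -z.im⟩ : ℂ)‖ := by
    rw [← sq_le_sq₀ (by positivity) (norm_nonneg _), mul_pow, ← Complex.normSq_eq_norm_sq,
      ← Complex.normSq_eq_norm_sq, Complex.normSq_apply, Complex.normSq_apply]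
    have : r ^ 2 ≤ 1 := by nlinarith
    nlinarith [mul_self_nonneg z.im]
  rw [slide, norm_div, Complex.norm_real, Real.norm_of_nonneg (by positivity)]
  refine div_le_of_le_mul₀ (norm_nonneg _) (norm_nonneg _) ?_
  nlinarith [norm_nonneg z]

/-- Inversion turns circle `n` into the line `Re = n / 2`. For `r ≠ 0`, `slide r` divides the
imaginary part of `1 / z` by `r`, which preserves that line; as `r` tends to `0` the point escapes
to infinity, that is, to the origin of the earring. -/
theorem slide_mem {n : ℕ+} {z : ℂ} (hz : z ∈ earringCircle n) (him : z.im ≠ 0) (r : ℝ) :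
    slide r z ∈ earringCircle n := by
  rw [mem_earringCircle_iff] at *
  have h2 : Complex.normSq ⟨r * z.re, -z.im⟩ ≠ 0 := by
    rw [Ne, Complex.normSq_eq_zero]
    intro h
    exact him (neg_eq_zero.1 (congrArg Complex.im h))
  have h3 : Complex.normSq ⟨r * z.re, -z.im⟩ = (r * z.re) ^ 2 + z.im ^ 2 := by
    rw [Complex.normSq_apply]; ring
  rw [← Complex.normSq_eq_norm_sq, slide, Complex.normSq_div, Complex.div_re, Complex.normSq_ofReal]
  simp only [Complex.ofReal_re, Complex.ofReal_im]
  field_simp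
  linear_combination r ^ 2 * ‖z‖ ^ 2 * hz

theorem continuousAt_slide {r : ℝ} {z : ℂ} (h : z.im ≠ 0) :
    ContinuousAt (fun p : ℝ × ℂ => slide p.1 p.2) (r, z) := by
  have e : (fun p : ℝ × ℂ => slide p.1 p.2) = fun p : ℝ × ℂ =>
      ((p.1 * ‖p.2‖ ^ 2 : ℝ) : ℂ) / (p.1 * p.2.re - p.2.im * Complex.I) := by
    ext p
    rw [slide]
    congr 1
    apply Complex.ext <;> simp
  rw [e]
  refine ContinuousAt.div (by fun_prop) (by fun_prop) fun h' => h ?_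
  simpa using congrArg Complex.im h'

open Classical in
/-- The contraction of the arcs near the origin of the circles of index at most `k`. -/
def slideSmall (k : ℕ+) (r : ℝ) (z : ℂ) : ℂ := if z ∈ petals {m | m ≤ k} then slide r z else z

theorem slideSmall_mem {k : ℕ+} (r : ℝ) {z : ℂ} (hz : z ∈ earring) (h : ‖z‖ < 2 / k) :
    slideSmall k r z ∈ earring := by
  rw [slideSmall]
  split_ifs with h'
  · obtain ⟨n, hn⟩ := h'.2
    exact Set.mem_iUnion.2 ⟨n, slide_mem hn.2 (im_ne_zero h' h) r⟩
  · exact hz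

theorem slideSmall_one (k : ℕ+) (z : ℂ) : slideSmall k 1 z = z := by
  rw [slideSmall, slide_one, ite_self]

theorem slideSmall_zero (k : ℕ+) (z : earring) :
    slideSmall k 0 z = 0 ∨ slideSmall k 0 z ∈ petals {m | k < m} := by
  by_cases h : (z : ℂ) ∈ petals {m | m ≤ k}
  · left; rw [slideSmall, if_pos h, slide_zero]
  · rw [slideSmall, if_neg h]
    rcases petals_or {m | m ≤ k} z with h1 | h1 | h1
    · left; exact congrArg Subtype.val h1
    · exact absurd h1 h
    · right
      have : {m | m ≤ k}ᶜ = {m | k < m} := by ext; simp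
      rwa [this] at h1

/-- Away from the origin the index of the circle is locally constant. At the origin `norm_slide_le`
gives continuity, since sliding never increases the norm. -/
theorem continuous_slideSmall {Z : Type*} [TopologicalSpace Z] {k : ℕ+} {r : Z → ℝ}
    {p : Z → earring} (hr : Continuous r) (hp : Continuous p) (hr0 : ∀ z, 0 ≤ r z)
    (hr1 : ∀ z, r z ≤ 1) (h : ∀ z, ‖(p z : ℂ)‖ < 2 / k) :
    Continuous fun z => slideSmall k (r z) (p z) := by
  have hp' : Continuous fun z => (p z : ℂ) := continuous_subtype_val.comp hp
  rw [continuous_iff_continuousAt]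
  intro z
  refine continuousAt_ite_petals (f := fun z => slide (r z) (p z)) (g := fun z => (p z : ℂ))
    hp.continuousAt (fun h' => ?_) (fun _ => hp'.continuousAt)
    (fun h0 => ⟨?_, hp'.continuousAt, ?_⟩)
  · have h1 : Filter.Tendsto (fun z => (r z, (p z : ℂ))) (nhds z) (nhds (r z, (p z : ℂ))) :=
      (hr.prodMk hp').tendsto z
    exact (continuousAt_slide (r := r z) (im_ne_zero h' (h z))).tendsto.comp h1
  · have h0 : (p z : ℂ) = 0 := congrArg Subtype.val h0
    have h1 : slide (r z) (p z) = 0 := by rw [h0]; simp [slide]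
    rw [ContinuousAt, h1]
    have h2 : Filter.Tendsto (fun z => ‖(p z : ℂ)‖) (nhds z) (nhds 0) := by
      have := hp'.norm.tendsto z
      rwa [h0, norm_zero] at this
    exact squeeze_zero_norm (fun q => norm_slide_le (hr0 q) (hr1 q) _) h2
  · have h0 : (p z : ℂ) = 0 := congrArg Subtype.val h0
    rw [h0]
    simp [slide]

/-- A loop near the origin is freely homotopic to a loop in the circles of large index. -/
theorem exists_joined_of_norm_lt {k : ℕ+} {l : FreeLoop earring}
    (hl : ∀ t, ‖(l.1 t : ℂ)‖ < 2 / k) :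
    ∃ l' : FreeLoop earring, Joined l l' ∧ l'.map (retract {m | k < m}) = l' := by
  let F : C(I × I, earring) :=
    ⟨fun p : I × I => ⟨slideSmall k (unitInterval.symm p.1) (l.1 p.2),
      slideSmall_mem _ (l.1 p.2).2 (hl _)⟩,
      (continuous_slideSmall (by fun_prop) (by fun_prop)
        (fun p : I × I => (unitInterval.symm p.1).2.1)
        (fun p : I × I => (unitInterval.symm p.1).2.2) (fun p : I × I => hl p.2)).subtype_mk _⟩
  have hF (s t : I) : (F (s, t) : ℂ) = slideSmall k (unitInterval.symm s) (l.1 t) := rfl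
  have hcl (s : I) : F (s, 0) = F (s, 1) := Subtype.ext (by rw [hF, hF, l.2])
  refine ⟨⟨F.comp (sliceLeft 1), hcl 1⟩, joined_iff_exists.2 ⟨F, fun t => Subtype.ext ?_,
    fun t => rfl, hcl⟩, Subtype.ext (ContinuousMap.ext fun t => ?_)⟩
  · rw [hF, unitInterval.symm_zero, Set.Icc.coe_one, slideSmall_one]
  · refine retract_eq_self ?_
    have h := slideSmall_zero k (l.1 t)
    have h1 := hF 1 t
    rw [unitInterval.symm_one, Set.Icc.coe_zero] at h1
    rw [← h1] at h
    exact h.imp_left fun h => Subtype.ext h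

end Contraction

/-! ### Null-homotopy by successive shrinking -/

section Shrinking

theorem continuous_freeLoop_map {X Z : Type*} [TopologicalSpace X] [TopologicalSpace Z]
    (f : C(X, Z)) : Continuous (FreeLoop.map f) := by
  unfold FreeLoop.map; fun_prop

/-- A loop that can be successively moved into smaller and smaller parts of the earring is
null-homotopic. -/
theorem joined_const_of_shrinking (l : ℕ → FreeLoop earring)
    (hl : ∀ k, (l k).map (retract {m | k.succPNat < m}) = l k)
    (h : ∀ k, Joined (l k) (l (k + 1))) : Joined (l 0) (constLoop origin) := by
  have hl' (k) : (l (k + 1)).map (retract {m | k.succPNat < m}) = l (k + 1) := by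
    rw [← hl (k + 1)]
    ext1
    ext1 t
    refine retract_eq_self ?_
    rcases retract_eq_or {m | (k + 1).succPNat < m} ((l (k + 1)).1 t) with h | ⟨h0, m, hm, hz⟩
    · exact Or.inl h
    · refine Or.inr ⟨h0, m, lt_trans (b := (k + 1).succPNat) ?_ hm, hz⟩
      exact Nat.succPNat_lt_succPNat.2 k.lt_succ_self
  let q (k) := (h k).somePath
  -- Retracting the homotopy leaves both ends unchanged and confines it to circles of index greater
  -- than `k + 1`, hence to norm at most `2 / (k + 1)`.
  let p (k) : Path (l k) (l (k + 1)) :=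
    ((q k).map (continuous_freeLoop_map (retract {m | k.succPNat < m}))).cast (hl k).symm
      (hl' k).symm
  refine joined_of_tendsto p fun N hN => ?_
  obtain ⟨ε, hε, hN⟩ := Metric.mem_nhds_iff.1 hN
  obtain ⟨K, hK⟩ := exists_nat_gt (2 / ε)
  filter_upwards [Filter.eventually_ge_atTop K] with k hk
  rintro _ ⟨s, rfl⟩
  refine hN ?_
  rw [Metric.mem_ball, Subtype.dist_eq]
  have hk0 : (0 : ℝ) < k.succPNat := by exact_mod_cast k.succPNat.pos
  have h1 : 2 / (k.succPNat : ℝ) < ε := by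
    rw [div_lt_iff₀ hk0]
    rw [div_lt_iff₀ hε] at hK
    have h2 : (K : ℝ) ≤ k.succPNat := by
      rw [Nat.succPNat_coe]; exact_mod_cast hk.trans k.le_succ
    nlinarith
  refine lt_of_le_of_lt ((ContinuousMap.dist_le (by positivity)).2 fun t => ?_) h1
  rw [Subtype.dist_eq]
  change dist ((retract {m | k.succPNat < m} ((q k s).1 t) : earring) : ℂ) 0 ≤ _
  rw [dist_zero_right]
  rcases retract_eq_or {m | k.succPNat < m} ((q k s).1 t) with h | h
  · rw [h]
    change ‖(0 : ℂ)‖ ≤ _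
    rw [norm_zero]
    positivity
  · exact norm_le_of_mem_petals h

end Shrinking

end

end HawaiianPants

namespace HawaiianPants

noncomputable section

/-! ### Geometry of the pair of pants -/

section Pants

/-- The centers of the three boundary circles of the pair of pants. -/
def center : Fin 3 → ℂ := ![0, 2 * Complex.I, -(2 * Complex.I)]

/-- The radii of the three boundary circles of the pair of pants. -/
def radius : Fin 3 → ℝ := ![4, 1, 1]

/-- The sign that says on which side of a boundary circle the pair of pants lies. -/
def side : Fin 3 → ℝ := ![-1, 1, 1]

/-- The indices of the three circles to which the `n`-th pair of pants is attached. -/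
def label (n : ℕ+) : Fin 3 → ℕ+ := ![n, 2 * n, 2 * n + 1]

/-- The signed distance to a boundary circle of the pair of pants. -/
def depth (j : Fin 3) (z : ℂ) : ℝ := side j * (‖z - center j‖ - radius j)

theorem abs_side (j : Fin 3) : |side j| = 1 := by
  fin_cases j <;> simp [side]

theorem one_le_radius (j : Fin 3) : 1 ≤ radius j := by
  fin_cases j <;> simp [radius]

theorem mem_pants_iff {z : ℂ} : z ∈ pants ↔ ∀ j, 0 ≤ depth j z := by
  rw [pants, Set.mem_sdiff, Set.mem_union, mem_closedBall_iff_norm, mem_ball_iff_norm,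
    mem_ball_iff_norm, sub_zero, not_or, not_lt, not_lt, Fin.forall_fin_succ, Fin.forall_fin_two]
  simp [depth, side, radius, center]

theorem continuous_depth (j : Fin 3) : Continuous (depth j) := by
  unfold depth; fun_prop

/-- The boundary circles are at distance at least `1` from each other. So collars of depth less than
`1 / 2` are disjoint, and at depth exactly `1 / 2` the cutoffs vanish. -/
theorem one_le_depth_add {i j : Fin 3} (hij : i ≠ j) (z : ℂ) : 1 ≤ depth i z + depth j z := by
  have h1 := norm_sub_norm_le (z - 2 * Complex.I) z
  have h2 := norm_sub_norm_le (z - -(2 * Complex.I)) z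
  have h3 := norm_sub_le (z - -(2 * Complex.I)) (z - 2 * Complex.I)
  rw [show z - -(2 * Complex.I) - (z - 2 * Complex.I) = 4 * Complex.I by ring, norm_four_I] at h3
  have h4 := norm_sub_norm_le z (z - 2 * Complex.I)
  have h5 := norm_sub_norm_le z (z - -(2 * Complex.I))
  rw [sub_sub_cancel, norm_two_I] at h4
  rw [sub_sub_cancel, norm_neg, norm_two_I] at h5
  fin_cases i <;> fin_cases j <;> simp [depth, side, radius, center] at hij h3 h4 h5 ⊢ <;> linarith

theorem depth_le_add_norm (j : Fin 3) (z w : ℂ) : depth j z ≤ depth j w + ‖w - z‖ := by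
  have h1 := abs_norm_sub_norm_le (z - center j) (w - center j)
  rw [sub_sub_sub_cancel_right, norm_sub_rev z w] at h1
  have h2 : depth j z - depth j w = side j * (‖z - center j‖ - ‖w - center j‖) := by
    rw [depth, depth]; ring
  have h3 : |depth j z - depth j w| ≤ ‖w - z‖ := by
    rwa [h2, abs_mul, abs_side, one_mul]
  linarith [le_abs_self (depth j z - depth j w)]

theorem one_le_norm_sub_center {j : Fin 3} {z : ℂ} (h0 : 0 ≤ depth j z) (h : depth j z ≤ 1 / 2) :
    1 ≤ ‖z - center j‖ := by
  fin_cases j <;> simp [depth, center, radius, side] at * <;> linarith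

/-- The direction of a point as seen from the center of a boundary circle. -/
def dir (j : Fin 3) (z : ℂ) : ℂ := (z - center j) / (max ‖z - center j‖ 1 : ℝ)

/-- The maximum with `1` keeps the denominator away from zero; on the collars it has no effect by
`one_le_norm_sub_center`. -/
theorem continuous_dir (j : Fin 3) : Continuous (dir j) := by
  unfold dir
  refine Continuous.div (by fun_prop) (by fun_prop) fun z h => ?_
  have h1 : max ‖z - center j‖ 1 = 0 := by exact_mod_cast h
  linarith [le_max_right ‖z - center j‖ 1]

theorem norm_mul_dir {j : Fin 3} {z : ℂ} (h : 1 ≤ ‖z - center j‖) :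
    ‖z - center j‖ * dir j z = z - center j := by
  have h0 : (‖z - center j‖ : ℂ) ≠ 0 := by
    rw [Ne, Complex.ofReal_eq_zero]; linarith
  rw [dir, max_eq_left h]
  field_simp

theorem norm_dir {j : Fin 3} {z : ℂ} (h : 1 ≤ ‖z - center j‖) : ‖dir j z‖ = 1 := by
  rw [dir, max_eq_left h, norm_div, Complex.norm_real, norm_norm, div_self (by linarith)]

/-- A cutoff function supported near a boundary circle. -/
def bump (j : Fin 3) (z : ℂ) : ℝ := max 0 (min 1 (2 - 4 * depth j z))

theorem continuous_bump (j : Fin 3) : Continuous (bump j) := by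
  have := continuous_depth j
  unfold bump; fun_prop

theorem bump_nonneg (j : Fin 3) (z : ℂ) : 0 ≤ bump j z := le_max_left _ _

theorem bump_le_one (j : Fin 3) (z : ℂ) : bump j z ≤ 1 := max_le zero_le_one (min_le_left _ _)

theorem bump_eq_zero {j : Fin 3} {z : ℂ} (h : 1 / 2 ≤ depth j z) : bump j z = 0 :=
  max_eq_left ((min_le_right _ _).trans (by linarith))

theorem bump_eq_one {j : Fin 3} {z : ℂ} (h : depth j z ≤ 1 / 4) : bump j z = 1 := by
  rw [bump, min_eq_left (by linarith), max_eq_right zero_le_one]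

theorem bump_eq_zero_of_ne {i j : Fin 3} {z : ℂ} (h : depth j z ≤ 1 / 2) (hij : i ≠ j) :
    bump i z = 0 := bump_eq_zero (by linarith [one_le_depth_add hij z])

/-- A point of a boundary circle of the pair of pants. -/
def boundaryPoint (j : Fin 3) (θ : ℝ) : ℂ := center j + radius j * clockwiseUnit θ

theorem norm_boundaryPoint_sub (j : Fin 3) (θ : ℝ) : ‖boundaryPoint j θ - center j‖ = radius j := by
  rw [boundaryPoint, add_sub_cancel_left, norm_mul, norm_clockwiseUnit, mul_one, Complex.norm_real,
    Real.norm_of_nonneg (by linarith [one_le_radius j])]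

theorem depth_boundaryPoint (j : Fin 3) (θ : ℝ) : depth j (boundaryPoint j θ) = 0 := by
  rw [depth, norm_boundaryPoint_sub, sub_self, mul_zero]

theorem boundaryPoint_mem (j : Fin 3) (θ : ℝ) : boundaryPoint j θ ∈ pants := by
  refine mem_pants_iff.2 fun i => ?_
  by_cases hij : i = j
  · rw [hij, depth_boundaryPoint]
  · have := one_le_depth_add hij (boundaryPoint j θ)
    rw [depth_boundaryPoint] at this
    linarith

theorem dir_boundaryPoint (j : Fin 3) (θ : ℝ) : dir j (boundaryPoint j θ) = clockwiseUnit θ := by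
  have h0 : (radius j : ℂ) ≠ 0 := by
    rw [Ne, Complex.ofReal_eq_zero]; linarith [one_le_radius j]
  rw [dir, norm_boundaryPoint_sub, max_eq_left (one_le_radius j), boundaryPoint]
  field_simp
  ring

/-- The homotopy of the pair of pants that pushes collars of the boundary circles to the boundary. -/
def push (s : ℝ) (z : ℂ) : ℂ :=
  z + ∑ j, ((s * bump j z : ℝ) : ℂ) * (center j + radius j * dir j z - z)

theorem continuous_push : Continuous fun p : ℝ × ℂ => push p.1 p.2 := by
  have h1 := continuous_bump
  have h2 := continuous_dir
  unfold push
  fun_prop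

theorem push_zero (z : ℂ) : push 0 z = z := by simp [push]

theorem push_eq {j : Fin 3} {z : ℂ} (h : depth j z ≤ 1 / 2) (s : ℝ) :
    push s z = z + ((s * bump j z : ℝ) : ℂ) * (center j + radius j * dir j z - z) := by
  rw [push, Finset.sum_eq_single j]
  · intro i _ hij
    rw [bump_eq_zero_of_ne h hij]; simp
  · simp

theorem push_eq_self {z : ℂ} (h : ∀ j, 1 / 2 ≤ depth j z) (s : ℝ) : push s z = z := by
  simp [push, bump_eq_zero (h _)]

theorem push_boundaryPoint (j : Fin 3) (θ s : ℝ) :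
    push s (boundaryPoint j θ) = boundaryPoint j θ := by
  rw [push_eq (j := j) (by rw [depth_boundaryPoint]; norm_num), dir_boundaryPoint]
  simp [boundaryPoint]

/-- A point of collar `j` moves radially by at most its depth, which is at most `1 / 2`. Its depth
at `j` is scaled by `1 - r ≥ 0`; the other depths, initially at least `1 - depth j z`, stay
nonnegative. -/
theorem push_mem {s : ℝ} (h0 : 0 ≤ s) (h1 : s ≤ 1) {z : ℂ} (hz : z ∈ pants) :
    push s z ∈ pants := by
  by_cases h : ∃ j, depth j z ≤ 1 / 2
  · obtain ⟨j, hj⟩ := h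
    have hd := mem_pants_iff.1 hz j
    have hN := one_le_norm_sub_center hd hj
    have hr := one_le_radius j
    set r := s * bump j z with hr'
    have hr0 : 0 ≤ r := mul_nonneg h0 (bump_nonneg j z)
    have hr1 : r ≤ 1 := mul_le_one₀ h1 (bump_nonneg j z) (bump_le_one j z)
    have e1 : push s z - z = ((r * (radius j - ‖z - center j‖) : ℝ) : ℂ) * dir j z := by
      rw [push_eq hj, ← hr']
      push_cast
      linear_combination (r : ℂ) * (norm_mul_dir hN)
    have e2 : push s z - center j =
        (((1 - r) * ‖z - center j‖ + r * radius j : ℝ) : ℂ) * dir j z := by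
      push_cast at e1 ⊢
      linear_combination e1 - norm_mul_dir hN
    have hdist : ‖z - push s z‖ ≤ depth j z := by
      rw [norm_sub_rev, e1, norm_mul, norm_dir hN, mul_one, Complex.norm_real, Real.norm_eq_abs,
        abs_mul, abs_of_nonneg hr0]
      have : depth j z = |radius j - ‖z - center j‖| := by
        rw [← abs_of_nonneg hd, depth, abs_mul, abs_side, one_mul, abs_sub_comm]
      rw [this]
      exact mul_le_of_le_one_left (abs_nonneg _) hr1
    refine mem_pants_iff.2 fun i => ?_
    by_cases hij : i = j
    · subst hij
      have h3 : 0 ≤ (1 - r) * ‖z - center i‖ := mul_nonneg (by linarith) (norm_nonneg _)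
      have h4 : 0 ≤ r * radius i := mul_nonneg hr0 (by linarith)
      have h2 : depth i (push s z) = (1 - r) * depth i z := by
        rw [depth, e2, norm_mul, norm_dir hN, mul_one, Complex.norm_real,
          Real.norm_of_nonneg (add_nonneg h3 h4), depth]
        ring
      rw [h2]
      exact mul_nonneg (by linarith) hd
    · have h2 := depth_le_add_norm i z (push s z)
      rw [norm_sub_rev] at h2
      linarith [one_le_depth_add hij z]
  · push Not at h
    rw [push_eq_self fun j => (h j).le]
    exact hz

theorem push_one {j : Fin 3} {z : ℂ} (h0 : 0 ≤ depth j z) (h : depth j z ≤ 1 / 4) :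
    push 1 z = boundaryPoint j (angleParam (dir j z)) := by
  have hN := one_le_norm_sub_center h0 (by linarith)
  have h1 := norm_mul_clockwiseUnit_angleParam (dir j z)
  rw [norm_dir hN, Complex.ofReal_one, one_mul] at h1
  rw [push_eq (j := j) (by linarith), bump_eq_one h, boundaryPoint, h1]
  simp

/-- The distance of a point of the pair of pants to the boundary. -/
def minDepth (z : ℂ) : ℝ := min (depth 0 z) (min (depth 1 z) (depth 2 z))

theorem continuous_minDepth : Continuous minDepth := by
  have := continuous_depth
  unfold minDepth; fun_prop

theorem minDepth_lt_iff {z : ℂ} {r : ℝ} : minDepth z < r ↔ ∃ j, depth j z < r := by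
  rw [minDepth, min_lt_iff, min_lt_iff, Fin.exists_fin_succ, Fin.exists_fin_two]; rfl

theorem lt_minDepth_iff {z : ℂ} {r : ℝ} : r < minDepth z ↔ ∀ j, r < depth j z := by
  rw [minDepth, lt_min_iff, lt_min_iff, Fin.forall_fin_succ, Fin.forall_fin_two]; rfl

theorem minDepth_nonneg {z : ℂ} (hz : z ∈ pants) : 0 ≤ minDepth z := by
  have := mem_pants_iff.1 hz
  exact le_min (this 0) (le_min (this 1) (this 2))

theorem minDepth_boundaryPoint (j : Fin 3) (θ : ℝ) : minDepth (boundaryPoint j θ) = 0 := by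
  refine le_antisymm (le_of_not_gt fun h => ?_) (minDepth_nonneg (boundaryPoint_mem j θ))
  have := lt_minDepth_iff.1 h j
  rw [depth_boundaryPoint] at this
  exact lt_irrefl _ this

/-- The map from the `n`-th pair of pants to the plane that extends the attaching maps. -/
def collarMap (n : ℕ+) (z : ℂ) : ℂ := ∑ j, (bump j z : ℂ) * ((1 + dir j z) / label n j)

theorem continuous_collarMap (n : ℕ+) : Continuous (collarMap n) := by
  have h1 := continuous_bump
  have h2 := continuous_dir
  unfold collarMap
  fun_prop

theorem collarMap_eq {j : Fin 3} {z : ℂ} (h : depth j z ≤ 1 / 4) (n : ℕ+) :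
    collarMap n z = (1 + dir j z) / label n j := by
  rw [collarMap, Finset.sum_eq_single j]
  · rw [bump_eq_one h]; simp
  · intro i _ hij
    rw [bump_eq_zero_of_ne (by linarith) hij]; simp
  · simp

theorem collarMap_eq_curve {j : Fin 3} {z : ℂ} (h0 : 0 ≤ depth j z) (h : depth j z ≤ 1 / 4)
    {θ : ℝ} (hθ : z - center j = ‖z - center j‖ * clockwiseUnit θ) (n : ℕ+) :
    collarMap n z = earringCurve (label n j) θ := by
  have hN := one_le_norm_sub_center h0 (by linarith)
  have h1 : (‖z - center j‖ : ℂ) ≠ 0 := by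
    rw [Ne, Complex.ofReal_eq_zero]; linarith
  rw [collarMap_eq h, earringCurve_coe,
    mul_left_cancel₀ h1 ((norm_mul_dir hN).trans hθ)]

end Pants

/-! ### Maps into and out of the Hawaiian pants -/

section Space

/-- The map from the earring to the Hawaiian pants. -/
def earringMap : C(earring, Space) :=
  ⟨fun z => Quot.mk _ (Sum.inl z), continuous_quot_mk.comp continuous_inl⟩

/-- The map from the `n`-th pair of pants to the Hawaiian pants. -/
def pantsMap (n : ℕ+) : C(pants, Space) :=
  ⟨fun z => Quot.mk _ (Sum.inr ⟨n, z⟩), continuous_quot_mk.comp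
    (continuous_inr.comp continuous_sigmaMk)⟩

theorem Space.exists_rep (x : Space) :
    (∃ z, x = earringMap z) ∨ ∃ n z, x = pantsMap n z := by
  obtain ⟨z | ⟨n, z⟩, rfl⟩ := Quot.exists_rep x
  · exact Or.inl ⟨z, rfl⟩
  · exact Or.inr ⟨n, z, rfl⟩

theorem outerLoop_eq (t : I) : outerLoop t = ⟨boundaryPoint 0 t, boundaryPoint_mem 0 t⟩ := by
  ext1
  simp [outerLoop, clockwise, boundaryPoint, clockwiseUnit, center, radius]

theorem innerLoop₁_eq (t : I) : innerLoop₁ t = ⟨boundaryPoint 1 t, boundaryPoint_mem 1 t⟩ := by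
  ext1
  simp [innerLoop₁, clockwise, boundaryPoint, clockwiseUnit, center, radius, sub_eq_add_neg]

theorem innerLoop₂_eq (t : I) : innerLoop₂ t = ⟨boundaryPoint 2 t, boundaryPoint_mem 2 t⟩ := by
  ext1
  simp [innerLoop₂, clockwise, boundaryPoint, clockwiseUnit, center, radius, sub_eq_add_neg]

theorem pantsMap_boundaryPoint (n : ℕ+) (j : Fin 3) (θ : ℝ) :
    pantsMap n ⟨boundaryPoint j θ, boundaryPoint_mem j θ⟩ =
      earringMap (earringCurve (label n j) θ) := by
  have key (t : I) : pantsMap n ⟨boundaryPoint j t, boundaryPoint_mem j t⟩ =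
      earringMap (earringCurve (label n j) t) := by
    fin_cases j
    · have := Quot.sound (Attach.outer n t)
      rw [outerLoop_eq, earringLoop_eq] at this
      exact this
    · have := Quot.sound (Attach.inner₁ n t)
      rw [innerLoop₁_eq, earringLoop_eq] at this
      exact this
    · have := Quot.sound (Attach.inner₂ n t)
      rw [innerLoop₂_eq, earringLoop_eq] at this
      exact this
  -- The identifications are given for parameters in `[0, 1]`; periodicity extends them to the line.
  have h1 : clockwiseUnit θ = clockwiseUnit (Int.fract θ) :=
    clockwiseUnit_eq_iff.2 ⟨-⌊θ⌋, by rw [Int.fract]; push_cast; ring⟩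
  have h2 := key ⟨Int.fract θ, Int.fract_nonneg θ, (Int.fract_lt_one θ).le⟩
  convert h2 using 2
  · simp only [boundaryPoint, h1]
  · exact earringCurve_eq_iff.2 ⟨-⌊θ⌋, by simp [Int.fract, sub_eq_add_neg]⟩

/-- The continuous map on the Hawaiian pants that is given by compatible maps on its pieces. -/
def Space.lift {Z : Type*} [TopologicalSpace Z] (f : C(earring, Z)) (g : ℕ+ → C(pants, Z))
    (h : ∀ n j θ, g n ⟨boundaryPoint j θ, boundaryPoint_mem j θ⟩ =
      f (earringCurve (label n j) θ)) : C(Space, Z) where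
  toFun := Quot.lift (Sum.elim f fun p => g p.1 p.2) fun a b hab => by
    cases hab with
    | outer n t => rw [outerLoop_eq, earringLoop_eq]; exact h n 0 t
    | inner₁ n t => rw [innerLoop₁_eq, earringLoop_eq]; exact h n 1 t
    | inner₂ n t => rw [innerLoop₂_eq, earringLoop_eq]; exact h n 2 t
  continuous_toFun := continuous_quot_lift _
    (f.continuous.sumElim (continuous_sigma fun n => (g n).continuous))

end Space

end

end HawaiianPants

namespace HawaiianPants

noncomputable section

/-! ### The collar neighborhood and the interiors of the pants -/

section Charts

/-- The map from the Hawaiian pants to the plane that extends the inclusion of the earring. -/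
def planeMap : C(Space, ℂ) :=
  Space.lift ⟨fun z => z, continuous_subtype_val⟩
    (fun n => ⟨fun z => collarMap n z, (continuous_collarMap n).comp continuous_subtype_val⟩)
    fun n j θ => by
      refine collarMap_eq_curve (j := j) (by rw [depth_boundaryPoint])
        (by rw [depth_boundaryPoint]; norm_num) ?_ n
      change boundaryPoint j θ - center j = (‖boundaryPoint j θ - center j‖ : ℂ) * _
      rw [norm_boundaryPoint_sub, boundaryPoint, add_sub_cancel_left]

/-- The distance to the earring. -/
def height : C(Space, ℝ) :=
  Space.lift (ContinuousMap.const _ 0)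
    (fun _ => ⟨fun z => minDepth z, continuous_minDepth.comp continuous_subtype_val⟩)
    fun _ j θ => minDepth_boundaryPoint j θ

open Classical in
/-- The distance to the earring in the `n`-th pair of pants, and `0` elsewhere. -/
def heightAt (n : ℕ+) : C(Space, ℝ) :=
  Space.lift (ContinuousMap.const _ 0)
    (fun k => if k = n then ⟨fun z => minDepth z, continuous_minDepth.comp continuous_subtype_val⟩
      else ContinuousMap.const _ 0)
    fun k j θ => by split_ifs <;> simp [minDepth_boundaryPoint]

open Classical in
/-- The coordinate of the `n`-th pair of pants multiplied by the distance to the earring. -/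
def scaledCoord (n : ℕ+) : C(Space, ℂ) :=
  Space.lift (ContinuousMap.const _ 0)
    -- The factor vanishes on the boundary, so extension by zero is compatible with the
    -- identifications; dividing it out in `coord` recovers the coordinate on the open interior.
    (fun k => if k = n then ⟨fun z => minDepth z * z, by
        have := continuous_minDepth; fun_prop⟩
      else ContinuousMap.const _ 0)
    fun k j θ => by split_ifs <;> simp [minDepth_boundaryPoint]

/-- The neighborhood of the earring in the Hawaiian pants formed by the collars. -/
def collarSet : Set Space := {x | height x < 1 / 4}

/-- The interior of the `n`-th pair of pants in the Hawaiian pants. -/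
def pantsInterior (n : ℕ+) : Set Space := {x | 0 < heightAt n x}

theorem isOpen_collarSet : IsOpen collarSet := isOpen_lt height.continuous continuous_const

theorem isOpen_pantsInterior (n : ℕ+) : IsOpen (pantsInterior n) :=
  isOpen_lt continuous_const (heightAt n).continuous

theorem earringMap_mem (z : earring) : earringMap z ∈ collarSet := by
  change (0 : ℝ) < 1 / 4
  norm_num

theorem pantsMap_mem_collarSet {n : ℕ+} {z : pants} :
    pantsMap n z ∈ collarSet ↔ ∃ j, depth j z < 1 / 4 := minDepth_lt_iff

theorem pantsMap_mem_pantsInterior {n : ℕ+} {z : pants} :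
    pantsMap n z ∈ pantsInterior n ↔ 0 < minDepth z := by
  change 0 < (if n = n then _ else _ : C(pants, ℝ)) z ↔ _
  rw [if_pos rfl]; rfl

theorem exists_of_mem_pantsInterior {n : ℕ+} {x : Space} (h : x ∈ pantsInterior n) :
    ∃ z : pants, x = pantsMap n z ∧ 0 < minDepth z := by
  rcases x.exists_rep with ⟨z, rfl⟩ | ⟨k, z, rfl⟩
  · exact absurd h (lt_irrefl (0 : ℝ))
  · by_cases hk : k = n
    · subst hk
      exact ⟨z, rfl, pantsMap_mem_pantsInterior.1 h⟩
    · change 0 < (if k = n then _ else _ : C(pants, ℝ)) z at h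
      rw [if_neg hk] at h
      exact absurd h (lt_irrefl (0 : ℝ))

theorem eq_of_mem_pantsInterior {m n : ℕ+} {x : Space} (hm : x ∈ pantsInterior m)
    (hn : x ∈ pantsInterior n) : m = n := by
  obtain ⟨z, rfl, -⟩ := exists_of_mem_pantsInterior hm
  by_contra h
  change 0 < (if m = n then _ else _ : C(pants, ℝ)) z at hn
  rw [if_neg h] at hn
  exact lt_irrefl (0 : ℝ) hn

theorem mem_collarSet_or (x : Space) : x ∈ collarSet ∨ ∃ n, x ∈ pantsInterior n := by
  rcases x.exists_rep with ⟨z, rfl⟩ | ⟨n, z, rfl⟩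
  · exact Or.inl (earringMap_mem z)
  · by_cases h : minDepth z < 1 / 4
    · exact Or.inl h
    · exact Or.inr ⟨n, pantsMap_mem_pantsInterior.2 (by linarith)⟩

/-- The coordinate on the interior of the `n`-th pair of pants. -/
def coord (n : ℕ+) : C(pantsInterior n, ℂ) where
  toFun x := scaledCoord n x / heightAt n x
  continuous_toFun := Continuous.div (by fun_prop) (by fun_prop) fun x h =>
    x.2.ne' (by exact_mod_cast h)

theorem coord_eq {n : ℕ+} {x : pantsInterior n} {z : pants} (h : (x : Space) = pantsMap n z) :
    coord n x = z := by
  have hx := x.2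
  rw [h, pantsMap_mem_pantsInterior] at hx
  change scaledCoord n x / heightAt n x = _
  rw [h]
  change (if n = n then _ else _ : C(pants, ℂ)) z / (((if n = n then _ else _ : C(pants, ℝ)) z : ℝ) : ℂ) = _
  rw [if_pos rfl, if_pos rfl]
  change (minDepth z * z : ℂ) / minDepth z = _
  have : (minDepth z : ℂ) ≠ 0 := by exact_mod_cast hx.ne'
  field_simp

theorem coord_mem {n : ℕ+} (x : pantsInterior n) : ∃ h : coord n x ∈ pants,
    (x : Space) = pantsMap n ⟨coord n x, h⟩ ∧ ∀ j, 0 < depth j (coord n x) := by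
  obtain ⟨z, hz, h0⟩ := exists_of_mem_pantsInterior x.2
  have := coord_eq hz
  refine ⟨this ▸ z.2, ?_, ?_⟩
  · rw [hz]; congr 1; ext1; exact this.symm
  · rw [this]; exact lt_minDepth_iff.1 h0

/-- Because `planeMap` is defined and continuous on the whole quotient, the collar retraction
inherits continuity; only its values on the collars have to be located. -/
theorem planeMap_mem (x : Space) (hx : x ∈ collarSet) :
    planeMap x ∈ earring := by
  rcases x.exists_rep with ⟨z, rfl⟩ | ⟨n, z, rfl⟩
  · exact z.2
  · obtain ⟨j, hj⟩ := pantsMap_mem_collarSet.1 hx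
    have h0 := mem_pants_iff.1 z.2 j
    have := collarMap_eq_curve h0 hj.le
      (norm_mul_clockwiseUnit_angleParam ((z : ℂ) - center j)).symm n
    change collarMap n z ∈ _
    rw [this]
    exact Subtype.coe_prop _

/-- The retraction of the neighborhood of the earring to the earring. -/
def collarRetract : C(collarSet, earring) :=
  ⟨fun x => ⟨planeMap x, planeMap_mem x x.2⟩, by fun_prop⟩

/-- The homotopy of the Hawaiian pants that pushes the collars to the earring. -/
def pushHomotopy : C(Space, C(I, Space)) :=
  Space.lift (ContinuousMap.curry ⟨fun p : earring × I => earringMap p.1, by fun_prop⟩)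
    (fun n => ContinuousMap.curry ⟨fun p : pants × I =>
      pantsMap n ⟨push p.2 p.1, push_mem p.2.2.1 p.2.2.2 p.1.2⟩, by
        have : Continuous fun p : pants × I => push p.2 p.1 := continuous_push.comp
          (f := fun p : pants × I => ((p.2 : ℝ), (p.1 : ℂ))) (by fun_prop)
        fun_prop⟩)
    fun n j θ => by
      ext s
      change pantsMap n ⟨push s (boundaryPoint j θ), _⟩ = earringMap _
      rw [← pantsMap_boundaryPoint]
      congr 1
      ext1
      exact push_boundaryPoint j θ s

theorem pushHomotopy_zero (x : Space) : pushHomotopy x 0 = x := by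
  rcases x.exists_rep with ⟨z, rfl⟩ | ⟨n, z, rfl⟩
  · rfl
  · change pantsMap n ⟨push ((0 : I) : ℝ) z, _⟩ = _
    congr 1
    ext1
    exact push_zero _

theorem pushHomotopy_one (x : collarSet) : pushHomotopy x 1 = earringMap (collarRetract x) := by
  obtain ⟨x, hx⟩ := x
  rcases x.exists_rep with ⟨z, rfl⟩ | ⟨n, z, rfl⟩
  · rfl
  · obtain ⟨j, hj⟩ := pantsMap_mem_collarSet.1 hx
    have h0 := mem_pants_iff.1 z.2 j
    change pantsMap n ⟨push ((1 : I) : ℝ) z, _⟩ = _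
    have hN := one_le_norm_sub_center h0 (by linarith)
    have h1 := norm_mul_clockwiseUnit_angleParam (dir j z)
    rw [norm_dir hN, Complex.ofReal_one, one_mul] at h1
    have h2 := collarMap_eq_curve h0 hj.le (θ := angleParam (dir j z))
      (by rw [h1, norm_mul_dir hN]) n
    have h3 : collarRetract ⟨pantsMap n z, hx⟩ =
      earringCurve (label n j) (angleParam (dir j z)) := Subtype.ext h2
    rw [h3, ← pantsMap_boundaryPoint]
    congr 1
    ext1
    exact push_one h0 hj.le

/-- A loop near the earring is freely homotopic to its image under the retraction. -/
theorem joined_collarRetract {l : FreeLoop Space} (hl : ∀ t, l.1 t ∈ collarSet) :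
    ∃ l' : FreeLoop earring, (∀ t, (l'.1 t : ℂ) = planeMap (l.1 t)) ∧
      Joined l (l'.map earringMap) := by
  refine ⟨⟨collarRetract.comp (corestrict l.1 _ hl), Subtype.ext ?_⟩, fun t => rfl,
    joined_iff_exists.2 ⟨⟨fun p => pushHomotopy (l.1 p.2) p.1, by fun_prop⟩,
      fun t => pushHomotopy_zero _, fun t => pushHomotopy_one ⟨l.1 t, hl t⟩, fun s => ?_⟩⟩
  · exact congrArg planeMap l.2
  · change pushHomotopy (l.1 0) s = pushHomotopy (l.1 1) s
    rw [l.2]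

end Charts

end

end HawaiianPants

namespace HawaiianPants

noncomputable section

/-! ### Extending the representation over the pants -/

section PantsHolonomy

/-- The elements that represent the fundamental groupoid of the `n`-th pair of pants. -/
structure PantsRep (n : ℕ+) where
  /-- The image of the first inner boundary circle. -/
  x : Rep EarringGroup ℕ+
  /-- The image of the second inner boundary circle. -/
  y : Rep EarringGroup ℕ+
  /-- The transition at the boundary circles. -/
  trans : Fin 3 → Rep EarringGroup ℕ+
  comm : Commute x y
  outer : circleRep (label n 0) * trans 0 = trans 0 * (x * y)
  inner₁ : circleRep (label n 1) * trans 1 = trans 1 * x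
  inner₂ : circleRep (label n 2) * trans 2 = trans 2 * y

theorem nonempty_pantsRep (n : ℕ+) : Nonempty (PantsRep n) := by
  obtain ⟨x, y, p, u, w, h, hp, hu, hw⟩ := exists_commute_conj_earringRep (label n 0) (label n 1)
    (label n 2) (circleClass (label n 0)) (circleClass (label n 1)) (circleClass (label n 2))
  exact ⟨⟨x, y, ![p, u, w], h, hp, hu, hw⟩⟩

/-- A choice of representing elements. -/
def pantsRep (n : ℕ+) : PantsRep n := (nonempty_pantsRep n).some

/-- The coordinate of a point of a pair of pants relative to the center of an inner boundary
circle. -/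
def innerCoord (n : ℕ+) (j : Fin 3) (hj : side j = 1) : C(pantsInterior n, PuncturedPlane) where
  toFun x := ⟨coord n x - center j, fun h => by
    obtain ⟨-, -, h1⟩ := coord_mem x
    have := h1 j
    rw [depth, h, hj, norm_zero] at this
    linarith [one_le_radius j]⟩
  continuous_toFun := by fun_prop

theorem side_one : side 1 = 1 := rfl

theorem side_two : side 2 = 1 := rfl

/-- The holonomy on the interior of a pair of pants before the change of gauge. -/
def pantsHolAux (n : ℕ+) : Holonomy (pantsInterior n) (Rep EarringGroup ℕ+) :=
  ((crossingHol.pullback (innerCoord n 1 side_one)).prod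
    (crossingHol.pullback (innerCoord n 2 side_two))).map
    -- Since `x` and `y` commute, the crossing numbers about the two removed disks define a
    -- holonomy.
    (MonoidHom.noncommCoprod (zpowersHom _ (pantsRep n).x) (zpowersHom _ (pantsRep n).y)
      fun a b => (pantsRep n).comm.zpow_zpow a.toAdd b.toAdd)

/-- The change of the number of crossings between the centers of the disk and of a removed disk. -/
def outerShift (j : Fin 3) (z : ℂ) : ℤ := crossingShift z (1 - center j / z)

/-- The change of gauge on the interior of a pair of pants. -/
def pantsGauge (n : ℕ+) (x : pantsInterior n) : Rep EarringGroup ℕ+ :=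
  -- Only the values on the three disjoint collars matter, so the last branch also serves as a
  -- default elsewhere. The powers of `x` and `y` on the outer collar compensate for counting
  -- crossings about the removed disks instead of about `0`.
  if depth 0 (coord n x) < 1 / 4 then
    (pantsRep n).x ^ (-outerShift 1 (coord n x)) * (pantsRep n).y ^ (-outerShift 2 (coord n x)) *
      ((pantsRep n).trans 0)⁻¹
  else if depth 1 (coord n x) < 1 / 4 then ((pantsRep n).trans 1)⁻¹
  else ((pantsRep n).trans 2)⁻¹

/-- The holonomy on the interior of a pair of pants. -/
def pantsHol (n : ℕ+) : Holonomy (pantsInterior n) (Rep EarringGroup ℕ+) :=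
  (pantsHolAux n).gauge (pantsGauge n)

/-- The holonomy on the neighborhood of the earring. -/
def collarHol : Holonomy collarSet (Rep EarringGroup ℕ+) := earringRepHol.pullback collarRetract

/-- On the path, depth less than `1 / 4` at `j` is the same as depth at most `1 / 2`, so the
condition is clopen in time. -/
theorem exists_forall_depth_lt {f : C(I, ℂ)} (h : ∀ t, ∃ j, depth j (f t) < 1 / 4) :
    ∃ j, ∀ t, depth j (f t) < 1 / 4 := by
  obtain ⟨j, hj⟩ := h 0
  have hc : Continuous fun t => depth j (f t) := (continuous_depth j).comp f.continuous
  have e : {t | depth j (f t) < 1 / 4} = {t | depth j (f t) ≤ 1 / 2} := by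
    ext t
    refine ⟨fun ht => (show depth j (f t) < 1 / 4 from ht).le.trans (by norm_num), fun ht => ?_⟩
    obtain ⟨i, hi⟩ := h t
    by_cases hij : i = j
    · exact hij ▸ hi
    · have := one_le_depth_add hij (f t)
      have ht : depth j (f t) ≤ 1 / 2 := ht
      linarith
  have hclopen : IsClopen {t | depth j (f t) < 1 / 4} :=
    ⟨e ▸ isClosed_le hc continuous_const, isOpen_lt hc continuous_const⟩
  have := hclopen.eq_univ ⟨0, hj⟩
  exact ⟨j, fun t => (Set.ext_iff.1 this t).2 trivial⟩

/-- An angle function for `f` is also the parameter of the retracted path on the circle `label n j`,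
so both sides count the same crossings. -/
theorem collarHol_eq {g : C(I, Space)} {n : ℕ+} (hV : ∀ t, g t ∈ collarSet)
    (hW : ∀ t, g t ∈ pantsInterior n) {j : Fin 3} {f : C(I, PuncturedPlane)}
    (hf : ∀ t, (f t : ℂ) = coord n (corestrict g _ hW t) - center j)
    (hj : ∀ t, depth j (coord n (corestrict g _ hW t)) < 1 / 4) :
    collarHol.hol (corestrict g _ hV) = circleRep (label n j) ^ crossing f := by
  obtain ⟨θ, hθ⟩ := exists_isAngle f
  rw [hθ.crossing_eq, ← earringRepHol_curve]
  change earringRepHol.hol _ = _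
  congr 1
  ext1 t
  obtain ⟨hz, h1, h2⟩ := coord_mem (corestrict g _ hW t)
  have h3 : (corestrict g _ hV t : Space) = pantsMap n ⟨coord n (corestrict g _ hW t), hz⟩ := h1
  refine Subtype.ext ?_
  change planeMap (corestrict g _ hV t) = _
  rw [h3]
  have h4 := hθ t
  simp only [hf] at h4
  exact collarMap_eq_curve (h2 j).le (hj t).le h4 n

theorem conj_zpow_eq {Λ : Type*} [Group Λ] {a b c : Λ} (h : a * c = c * b) (k : ℤ) :
    a ^ k = c * b ^ k * c⁻¹ := by
  rw [← conj_zpow, ← h, mul_inv_cancel_right]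

theorem abs_im_sub_center {j : Fin 3} (hj : side j = 1) {z : ℂ} (h : depth j z < 1 / 4) :
    |(z - center j).im| < 5 / 4 := by
  refine (Complex.abs_im_le_norm _).trans_lt ?_
  fin_cases j <;> simp [side, depth, radius] at * <;> linarith

/-- On the outer collar `‖z‖ > 15 / 4`, while `‖center j‖ ≤ 2`. This makes `crossing_mul` applicable
to `z - center j = z * (1 - center j / z)`. -/
theorem re_one_sub_pos {j : Fin 3} {z : ℂ} (h : depth 0 z < 1 / 4) :
    0 < (1 - center j / z).re := by
  have h0 : 15 / 4 < ‖z‖ := by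
    simp [depth, side, radius, center] at h; linarith
  have h1 : ‖center j‖ ≤ 2 := by
    fin_cases j <;> simp [center]
  have h2 : ‖center j / z‖ < 1 := by
    rw [norm_div, div_lt_one (by linarith)]; linarith
  have h3 := (Complex.re_le_norm (center j / z)).trans_lt h2
  rw [Complex.sub_re, Complex.one_re]
  linarith

/-- By connectedness the path stays in one collar. On an inner collar the crossing number about the
other removed disk is zero, leaving a power of `x` or `y`. On the outer collar both crossing numbers
agree with that about `0` up to the shifts built into the gauge, leaving a power of `x * y`. The
transition elements then conjugate to the boundary value. -/
theorem collarHol_eq_pantsHol (n : ℕ+) (g : C(I, Space)) (hV : ∀ t, g t ∈ collarSet)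
    (hW : ∀ t, g t ∈ pantsInterior n) :
    collarHol.hol (corestrict g _ hV) = (pantsHol n).hol (corestrict g _ hW) := by
  set g' := corestrict g _ hW with hg'
  obtain ⟨j, hj⟩ : ∃ j, ∀ t, depth j (coord n (g' t)) < 1 / 4 := by
    refine exists_forall_depth_lt (f := (coord n).comp g') fun t => ?_
    obtain ⟨hz, h1, -⟩ := coord_mem (g' t)
    have h2 : (g' t : Space) ∈ collarSet := hV t
    rw [h1] at h2
    exact pantsMap_mem_collarSet.1 h2
  have hne {i : Fin 3} (hi : i ≠ j) (t : I) : ¬ depth i (coord n (g' t)) < 1 / 4 := by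
    have := one_le_depth_add hi (coord n (g' t))
    have := hj t
    linarith
  have hgauge : (pantsHol n).hol g' = (pantsGauge n (g' 0))⁻¹ *
      ((pantsRep n).x ^ crossing ((innerCoord n 1 side_one).comp g') *
      (pantsRep n).y ^ crossing ((innerCoord n 2 side_two).comp g')) * pantsGauge n (g' 1) := rfl
  rw [hgauge]
  have hcomm := (pantsRep n).comm
  have hcases : j = 0 ∨ j = 1 ∨ j = 2 := by fin_cases j <;> simp
  rcases hcases with rfl | rfl | rfl
  · have h0 (t : I) : coord n (g' t) ≠ 0 := fun h => by
      have := hj t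
      rw [h] at this
      simp [depth, side, radius, center] at this
      linarith
    let f : C(I, PuncturedPlane) := ⟨fun t => ⟨coord n (g' t), h0 t⟩, by fun_prop⟩
    have key (i : Fin 3) (hi : side i = 1) : crossing ((innerCoord n i hi).comp g') =
        crossing f + outerShift i (coord n (g' 1)) - outerShift i (coord n (g' 0)) := by
      refine crossing_mul (f := f) (v := ⟨fun t => 1 - center i / coord n (g' t), ?_⟩)
        (fun t => Or.inl (re_one_sub_pos (hj t))) (fun t => ?_)
      · exact Continuous.sub continuous_const (Continuous.div continuous_const (by fun_prop) h0)
      · change coord n (g' t) - center i = coord n (g' t) * (1 - center i / coord n (g' t))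
        have := h0 t
        field_simp
    rw [collarHol_eq hV hW (f := f) (fun t => by simp [f, center, hg']) hj, key, key,
      conj_zpow_eq (pantsRep n).outer, pantsGauge, pantsGauge, if_pos (hj 0), if_pos (hj 1),
      hcomm.mul_zpow]
    generalize outerShift 1 (coord n (g' 0)) = a
    generalize outerShift 1 (coord n (g' 1)) = b
    generalize outerShift 2 (coord n (g' 0)) = a'
    generalize outerShift 2 (coord n (g' 1)) = b'
    have e (k : ℤ) : (pantsRep n).x ^ k * (pantsRep n).y ^ k =
        (pantsRep n).y ^ a' * (pantsRep n).x ^ a * ((pantsRep n).x ^ (k + b - a) *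
          (pantsRep n).y ^ (k + b' - a')) * ((pantsRep n).x ^ (-b) * (pantsRep n).y ^ (-b')) := by
      have c1 := hcomm.zpow_zpow
      have hx : (pantsRep n).x ^ a * ((pantsRep n).x ^ (k + b - a)) =
          (pantsRep n).x ^ (k + b) := by rw [← zpow_add]; congr 1; ring
      calc _ = (pantsRep n).x ^ k * (pantsRep n).y ^ k := rfl
        _ = (pantsRep n).x ^ (k + b) * (pantsRep n).x ^ (-b) * (pantsRep n).y ^ k := by
          rw [← zpow_add]; congr 2; ring
        _ = (pantsRep n).x ^ (k + b) * ((pantsRep n).x ^ (-b) * (pantsRep n).y ^ (k + b')) *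
            (pantsRep n).y ^ (-b') := by
          rw [mul_assoc, mul_assoc, mul_assoc, ← zpow_add]; congr 3; ring
        _ = (pantsRep n).x ^ (k + b) * ((pantsRep n).y ^ (k + b') * (pantsRep n).x ^ (-b)) *
            (pantsRep n).y ^ (-b') := by rw [(c1 _ _).eq]
        _ = (pantsRep n).x ^ (k + b) * (pantsRep n).y ^ a' * ((pantsRep n).y ^ (k + b' - a')) *
            ((pantsRep n).x ^ (-b) * (pantsRep n).y ^ (-b')) := by
          rw [mul_assoc _ ((pantsRep n).y ^ a'), ← zpow_add, add_sub_cancel]; group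
        _ = _ := by
          rw [(c1 _ _).eq, ← hx]; group
    rw [e]
    group
  · rw [collarHol_eq hV hW (f := (innerCoord n 1 side_one).comp g') (fun t => rfl) hj,
      conj_zpow_eq (pantsRep n).inner₁, pantsGauge, pantsGauge, if_neg (hne (by decide) 0),
      if_pos (hj 0), if_neg (hne (by decide) 1), if_pos (hj 1),
      crossing_eq_zero (f := (innerCoord n 2 side_two).comp g')]
    · simp
    · intro t
      -- The path stays near height `2`, above the horizontal line through the center `-2i`, and so
      -- avoids the cut issuing from it.
      right
      have := abs_lt.1 (abs_im_sub_center (j := 1) rfl (hj t))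
      change (coord n (g' t) - center 2).im ≠ 0
      simp [center] at this ⊢
      linarith
  · rw [collarHol_eq hV hW (f := (innerCoord n 2 side_two).comp g') (fun t => rfl) hj,
      conj_zpow_eq (pantsRep n).inner₂, pantsGauge, pantsGauge, if_neg (hne (by decide) 0),
      if_neg (hne (by decide) 0), if_neg (hne (by decide) 1), if_neg (hne (by decide) 1),
      crossing_eq_zero (f := (innerCoord n 1 side_one).comp g')]
    · simp
    · intro t
      right
      have := abs_lt.1 (abs_im_sub_center (j := 2) rfl (hj t))
      change (coord n (g' t) - center 1).im ≠ 0
      simp [center] at this ⊢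
      linarith

/-- The open cover of the Hawaiian pants by the neighborhood of the earring and the interiors of
the pairs of pants. -/
def coverSet : Option ℕ+ → Set Space
  | none => collarSet
  | some n => pantsInterior n

/-- The holonomies on the sets of the cover. -/
def coverHol : ∀ i, Holonomy (coverSet i) (Rep EarringGroup ℕ+)
  | none => collarHol
  | some n => pantsHol n

theorem isOpen_coverSet : ∀ i, IsOpen (coverSet i)
  | none => isOpen_collarSet
  | some n => isOpen_pantsInterior n

theorem iUnion_coverSet : ⋃ i, coverSet i = Set.univ := by
  refine Set.eq_univ_of_forall fun x => ?_
  rcases mem_collarSet_or x with h | ⟨n, h⟩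
  · exact Set.mem_iUnion.2 ⟨none, h⟩
  · exact Set.mem_iUnion.2 ⟨some n, h⟩

theorem coverHol_compat : ∀ i j (g : C(I, Space)) (hi : ∀ t, g t ∈ coverSet i)
    (hj : ∀ t, g t ∈ coverSet j),
    (coverHol i).hol (corestrict g _ hi) = (coverHol j).hol (corestrict g _ hj) := by
  rintro (_ | n) (_ | m) g hi hj
  · rfl
  · exact collarHol_eq_pantsHol m g hi hj
  · exact (collarHol_eq_pantsHol n g hj hi).symm
  · obtain rfl := eq_of_mem_pantsInterior (hi 0) (hj 0)
    rfl

/-- Two loops in the earring that are freely homotopic in the Hawaiian pants are freely homotopic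
in the earring, unless the first one is null-homotopic. -/
theorem joined_of_joined_map {l l' : FreeLoop earring}
    (h : Joined (l.map earringMap) (l'.map earringMap)) :
    Joined l (constLoop origin) ∨ Joined l l' := by
  obtain ⟨F, h0, h1, hF⟩ := joined_iff_exists.1 h
  have hi : ∀ t, F.comp (sliceLeft 0) t ∈ coverSet none := fun t => by
    change F (0, t) ∈ collarSet
    rw [h0]; exact earringMap_mem _
  have hj : ∀ t, F.comp (sliceLeft 1) t ∈ coverSet none := fun t => by
    change F (1, t) ∈ collarSet
    rw [h1]; exact earringMap_mem _
  -- Both end loops lie in the collar neighborhood, where the holonomy is that of the earring; the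
  -- homotopy between them may cross any of the pants.
  obtain ⟨c, hc⟩ := exists_conj_of_freeHomotopy isOpen_coverSet iUnion_coverSet coverHol_compat
    F hF hi hj
  have e (r : I) (hr) (m : FreeLoop earring) (h : ∀ t, F (r, t) = earringMap (m.1 t)) :
      (coverHol none).hol (corestrict (F.comp (sliceLeft r)) _ hr) = earringRepHol.hol m.1 := by
    change earringRepHol.hol _ = _
    congr 1
    ext1 t
    refine Subtype.ext ?_
    change planeMap (F (r, t)) = _
    rw [h]; rfl
  rw [e 0 hi l h0, e 1 hj l' h1] at hc
  exact joined_of_earringRepHol_conj hc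

end PantsHolonomy

end

end HawaiianPants

namespace HawaiianPants

noncomputable section

/-! ### Path-connectedness -/

section PathConnected

theorem exists_pantsMap_eq {j : Fin 3} {z : pants} (h : depth j z = 0) (n : ℕ+) :
    ∃ u, pantsMap n z = earringMap u := by
  refine ⟨_, (congrArg (pantsMap n) (Subtype.ext ?_)).trans
    (pantsMap_boundaryPoint n j (angleParam (z - center j)))⟩
  have h1 : radius j = ‖(z : ℂ) - center j‖ := by
    fin_cases j <;> simp [depth, side] at h ⊢ <;> linarith
  change (z : ℂ) = center j + radius j * _
  rw [h1, norm_mul_clockwiseUnit_angleParam, add_sub_cancel]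

theorem exists_horizontal {a r : ℝ} (h : a ^ 2 ≤ r) : ∃ c : ℝ, c ^ 2 = r ∧
    ∀ s : I, a ^ 2 ≤ ((1 - s) * a + s * c) ^ 2 ∧ ((1 - s) * a + s * c) ^ 2 ≤ r := by
  have h0 : 0 ≤ r := (sq_nonneg a).trans h
  have h1 : |a| ≤ √r := Real.abs_le_sqrt h
  have h2 := Real.sq_sqrt h0
  rcases le_total 0 a with ha | ha
  · rw [abs_of_nonneg ha] at h1
    refine ⟨√r, h2, fun s => ?_⟩
    have e1 : a ≤ (1 - s) * a + s * √r := by nlinarith [s.2.1]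
    have e2 : (1 - s) * a + s * √r ≤ √r := by nlinarith [s.2.2]
    exact ⟨pow_le_pow_left₀ ha e1 2, (pow_le_pow_left₀ (ha.trans e1) e2 2).trans h2.le⟩
  · rw [abs_of_nonpos ha] at h1
    refine ⟨-√r, by rw [neg_sq, h2], fun s => ?_⟩
    have e1 : -a ≤ (1 - s) * -a + s * √r := by nlinarith [s.2.1]
    have e2 : (1 - s) * -a + s * √r ≤ √r := by nlinarith [s.2.2]
    rw [show (1 - s) * a + s * -√r = -((1 - s) * -a + s * √r) by ring, neg_sq, ← neg_sq a]
    have ha' : 0 ≤ -a := by linarith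
    exact ⟨pow_le_pow_left₀ ha' e1 2, (pow_le_pow_left₀ (ha'.trans e1) e2 2).trans h2.le⟩

theorem mem_pants_iff_sq {z : ℂ} : z ∈ pants ↔ z.re ^ 2 + z.im ^ 2 ≤ 16 ∧
    1 ≤ z.re ^ 2 + (z.im - 2) ^ 2 ∧ 1 ≤ z.re ^ 2 + (z.im + 2) ^ 2 := by
  have e (w : ℂ) : ‖w‖ ^ 2 = w.re ^ 2 + w.im ^ 2 := by
    rw [← Complex.normSq_eq_norm_sq, Complex.normSq_apply]; ring
  rw [pants, Set.mem_sdiff, Set.mem_union, mem_closedBall_iff_norm, mem_ball_iff_norm,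
    mem_ball_iff_norm, sub_zero, not_or, not_lt, not_lt,
    ← sq_le_sq₀ (norm_nonneg _) (by norm_num), ← sq_le_sq₀ zero_le_one (norm_nonneg _),
    ← sq_le_sq₀ zero_le_one (norm_nonneg _), e, e, e]
  norm_num

theorem joined_origin (x : Space) : Joined (earringMap origin) x := by
  have h (z : earring) : Joined (earringMap origin) (earringMap z) :=
    ⟨(arc z).map earringMap.continuous⟩
  rcases x.exists_rep with ⟨z, rfl⟩ | ⟨n, z, rfl⟩
  · exact h z
  · obtain ⟨h1, h2, h3⟩ := mem_pants_iff_sq.1 z.2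
    -- Moving horizontally away from the imaginary axis only increases the distances to the centers
    -- `±2i`; the motion ends on the outer circle.
    obtain ⟨c, hc, hs⟩ := exists_horizontal (a := (z : ℂ).re) (r := 16 - (z : ℂ).im ^ 2)
      (by linarith)
    let w (s : I) : ℂ := ((1 - s) * (z : ℂ).re + s * c : ℝ) + (z : ℂ).im * Complex.I
    have hw (s : I) : w s ∈ pants := by
      have := hs s
      refine mem_pants_iff_sq.2 ?_
      simp only [w, Complex.add_re, Complex.add_im, Complex.ofReal_re, Complex.ofReal_im,
        Complex.re_ofReal_mul, Complex.im_ofReal_mul, Complex.I_re, Complex.I_im, mul_zero,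
        mul_one, add_zero, zero_add]
      exact ⟨by linarith, by linarith, by linarith⟩
    let p : Path z ⟨w 1, hw 1⟩ := ⟨⟨fun s => ⟨w s, hw s⟩, by fun_prop⟩, by
      ext1; simp [w, Complex.re_add_im], rfl⟩
    obtain ⟨u, hu⟩ := exists_pantsMap_eq (j := 0) (z := ⟨w 1, hw 1⟩) (by
      have : ‖w 1‖ = 4 := by
        rw [← sq_eq_sq₀ (norm_nonneg _) (by norm_num), ← Complex.normSq_eq_norm_sq,
          Complex.normSq_apply]
        simp [w]
        linarith
      simp [depth, center, radius, this]) n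
    have hp : Joined (pantsMap n z) (earringMap u) := hu ▸ ⟨p.map (pantsMap n).continuous⟩
    exact (h u).trans hp.symm

end PathConnected

/-! ### Local behavior away from and at the origin -/

section LocallyContractible

/-- A neighborhood of a point whose loops are null-homotopic exists. -/
def SmallLoopsContract (x : Space) : Prop :=
  ∃ U, IsOpen U ∧ x ∈ U ∧ ∀ l : FreeLoop Space, (∀ t, l.1 t ∈ U) → ∃ y, Joined l (constLoop y)

/-- The disk of radius `minDepth z` about `z` lies in the pants, and loops in it contract linearly.
-/
theorem smallLoopsContract_pantsMap {n : ℕ+} {z : pants} (hz : 0 < minDepth z) :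
    SmallLoopsContract (pantsMap n z) := by
  have hmem {w : ℂ} (hw : ‖w - z‖ < minDepth z) : w ∈ pants := mem_pants_iff.2 fun j => by
    have h1 := depth_le_add_norm j z w
    by_contra! h2
    exact absurd (minDepth_lt_iff.2 ⟨j, (h1.trans_lt (by linarith))⟩) (lt_irrefl (minDepth z))
  have hx := pantsMap_mem_pantsInterior (n := n).2 hz
  refine ⟨Subtype.val '' {x : pantsInterior n | ‖coord n x - z‖ < minDepth z},
    (isOpen_pantsInterior n).isOpenMap_subtype_val _ (isOpen_lt (by fun_prop) continuous_const),
    ⟨⟨_, hx⟩, ?_, rfl⟩, fun l hl => ⟨pantsMap n z, ?_⟩⟩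
  · rw [Set.mem_ofPred_eq, coord_eq rfl, sub_self, norm_zero]
    exact hz
  · have hl1 (t : I) : l.1 t ∈ pantsInterior n := by
      obtain ⟨x, -, hx⟩ := hl t
      exact hx ▸ x.2
    have hl2 (t : I) : ‖coord n (corestrict l.1 _ hl1 t) - z‖ < minDepth z := by
      obtain ⟨x, h, hx⟩ := hl t
      rwa [show corestrict l.1 _ hl1 t = x from Subtype.ext hx.symm]
    have h01 : corestrict l.1 _ hl1 0 = corestrict l.1 _ hl1 1 := Subtype.ext l.2
    let w (p : I × I) : ℂ := z + (1 - p.1 : ℝ) * (coord n (corestrict l.1 _ hl1 p.2) - z)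
    have hw (p : I × I) : w p ∈ pants := by
      refine hmem (lt_of_le_of_lt ?_ (hl2 p.2))
      rw [add_sub_cancel_left, norm_mul, Complex.norm_real, Real.norm_of_nonneg (by
        linarith [p.1.2.2])]
      exact mul_le_of_le_one_left (norm_nonneg _) (by linarith [p.1.2.1])
    refine joined_iff_exists.2 ⟨⟨fun p => pantsMap n ⟨w p, hw p⟩, by fun_prop⟩, fun t => ?_,
      fun t => ?_, fun s => ?_⟩
    · obtain ⟨hz, h, -⟩ := coord_mem (corestrict l.1 _ hl1 t)
      refine Eq.trans (congrArg (pantsMap n) (Subtype.ext ?_)) h.symm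
      simp [w]
    · refine congrArg (pantsMap n) (Subtype.ext ?_)
      simp [w]
    · refine congrArg (pantsMap n) (Subtype.ext ?_)
      simp only [w, h01]

theorem mem_earringCircle_inv {n : ℕ+} {w : ℂ} (h : 2 * w.re = n) : w⁻¹ ∈ earringCircle n := by
  rw [mem_earringCircle_iff, norm_inv, inv_pow, ← Complex.normSq_eq_norm_sq, Complex.inv_re, ← h]
  ring

/-- After inversion the punctured circle is a vertical line; contracting it to its real point
contracts the loop to the point opposite the origin. -/
theorem joined_const_of_mem_petals {n : ℕ+} {l : FreeLoop earring}
    (hl : ∀ t, (l.1 t : ℂ) ∈ petals {n}) : ∃ z, Joined l (constLoop z) := by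
  have hre (t : I) : 2 * ((l.1 t : ℂ)⁻¹).re = n := by
    obtain ⟨h0, m, rfl, hm⟩ := hl t
    rw [mem_earringCircle_iff] at hm
    rw [Complex.inv_re, Complex.normSq_eq_norm_sq, ← mul_div_assoc, ← hm, mul_div_assoc, div_self,
      mul_one]
    simpa using h0
  let w (p : I × I) : ℂ := ((l.1 p.2 : ℂ)⁻¹).re +
    ((1 - p.1 : ℝ) * ((l.1 p.2 : ℂ)⁻¹).im : ℝ) * Complex.I
  have hw (p : I × I) : 2 * (w p).re = n := by
    simpa [w] using hre p.2
  have hw0 (p : I × I) : w p ≠ 0 := fun h => by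
    have := hw p
    rw [h, Complex.zero_re, mul_zero] at this
    exact n.ne_zero (by exact_mod_cast this.symm)
  have hinv : Continuous fun p : I × I => (l.1 p.2 : ℂ)⁻¹ :=
    Continuous.inv₀ (by fun_prop) fun p => (hl p.2).1
  have hwc : Continuous w := by
    have h1 := Complex.continuous_re.comp hinv
    have h2 := Complex.continuous_im.comp hinv
    simp only [Function.comp_def] at h1 h2
    fun_prop
  let F : C(I × I, earring) := ⟨fun p => ⟨(w p)⁻¹, Set.mem_iUnion.2 ⟨n,
    mem_earringCircle_inv (hw p)⟩⟩, (hwc.inv₀ hw0).subtype_mk _⟩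
  refine ⟨F (1, 0), joined_iff_exists.2 ⟨F, fun t => Subtype.ext ?_, fun t => Subtype.ext ?_,
    fun s => Subtype.ext ?_⟩⟩
  · change (w (0, t))⁻¹ = _
    simp only [w, Set.Icc.coe_zero, sub_zero, one_mul, Complex.re_add_im, inv_inv]
  · change (w (1, t))⁻¹ = (w (1, 0))⁻¹
    congr 1
    refine Complex.ext ?_ ?_
    · linarith [hw (1, t), hw (1, 0)]
    · simp [w]
  · change (w (s, 0))⁻¹ = (w (s, 1))⁻¹
    simp only [w, l.2]

theorem smallLoopsContract_earringMap {z : earring} (hz : z ≠ origin) :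
    SmallLoopsContract (earringMap z) := by
  obtain ⟨n, hn⟩ := Set.mem_iUnion.1 z.2
  refine ⟨Subtype.val '' {x : collarSet | (collarRetract x : ℂ) ∈ petals {n}},
    isOpen_collarSet.isOpenMap_subtype_val _
      ((isOpen_petals {n}).preimage collarRetract.continuous),
    ⟨⟨_, earringMap_mem z⟩, ⟨fun h => hz (Subtype.ext h), n, rfl, hn⟩, rfl⟩, fun l hl => ?_⟩
  obtain ⟨l', h1, h2⟩ := joined_collarRetract (l := l) fun t => by
    obtain ⟨x, -, hx⟩ := hl t
    exact hx ▸ x.2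
  obtain ⟨u, hu⟩ := joined_const_of_mem_petals (n := n) (l := l') fun t => by
    obtain ⟨x, h, hx⟩ := hl t
    rw [h1, ← hx]
    exact h
  exact ⟨earringMap u, h2.trans (joined_map earringMap hu)⟩

theorem smallLoopsContract_or (x : Space) : SmallLoopsContract x ∨ x = earringMap origin := by
  have h (z : earring) : SmallLoopsContract (earringMap z) ∨ earringMap z = earringMap origin := by
    by_cases hz : z = origin
    · exact Or.inr (congrArg _ hz)
    · exact Or.inl (smallLoopsContract_earringMap hz)
  rcases x.exists_rep with ⟨z, rfl⟩ | ⟨n, z, rfl⟩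
  · exact h z
  · rcases (minDepth_nonneg z.2).eq_or_lt with h0 | h0
    · obtain ⟨j, hj⟩ : ∃ j, depth j z = 0 := by
        by_contra! h1
        have := lt_minDepth_iff.2 fun j => (mem_pants_iff.1 z.2 j).lt_of_ne (h1 j).symm
        exact this.ne h0
      obtain ⟨u, hu⟩ := exists_pantsMap_eq hj n
      exact hu ▸ h u
    · exact Or.inl (smallLoopsContract_pantsMap h0)

/-- A loop in the Hawaiian pants that can be moved into every neighborhood of the origin is
null-homotopic. -/
theorem joined_const_of_forall_nhds {l : FreeLoop Space}
    (h : ∀ U, IsOpen U → earringMap origin ∈ U → ∃ l', Joined l l' ∧ ∀ t, l'.1 t ∈ U) :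
    ∃ y, Joined l (constLoop y) := by
  have key (k : ℕ) : ∃ l' : FreeLoop earring, Joined l (l'.map earringMap) ∧
      l'.map (retract {m | k.succPNat < m}) = l' := by
    -- The collar condition permits retraction to the earring; the norm bound is the one under which
    -- the circles of index at most `k + 1` can be slid away.
    obtain ⟨l₁, h1, hU⟩ := h (collarSet ∩ {x | ‖planeMap x‖ < 2 / k.succPNat})
      (isOpen_collarSet.inter (isOpen_lt (by fun_prop) continuous_const))
      ⟨earringMap_mem origin, by
        change ‖(0 : ℂ)‖ < _
        rw [norm_zero]; positivity⟩
    obtain ⟨l₂, h2, h3⟩ := joined_collarRetract fun t => (hU t).1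
    obtain ⟨l₃, h4, h5⟩ := exists_joined_of_norm_lt (k := k.succPNat) (l := l₂) fun t => by
      rw [h2]; exact (hU t).2
    exact ⟨l₃, (h1.trans h3).trans (joined_map earringMap h4), h5⟩
  choose f hf hr using key
  by_cases hc : ∃ k, Joined (f k) (constLoop origin)
  · obtain ⟨k, hk⟩ := hc
    exact ⟨earringMap origin, (hf k).trans (joined_map earringMap hk)⟩
  · push Not at hc
    -- If no loop of the sequence were null-homotopic in the earring, consecutive ones would be
    -- joined there, and shrinking would make the first one null-homotopic after all.
    have := joined_const_of_shrinking f hr fun k =>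
      (joined_of_joined_map ((hf k).symm.trans (hf (k + 1)))).resolve_left (hc k)
    exact absurd this (hc 0)

end LocallyContractible

/-! ### Conclusion -/

instance : PathConnectedSpace Space where
  nonempty := ⟨earringMap origin⟩
  joined x y := (joined_origin x).symm.trans (joined_origin y)

theorem stronglyHomotopicallyHausdorffAt (x : Space) :
    StronglyHomotopicallyHausdorffAt Space x := by
  intro b γ hγ
  by_contra! hU
  have h (U : Set Space) (hUo : IsOpen U) (hx : x ∈ U) :
      ∃ l', Joined (freeLoop γ) l' ∧ ∀ t, l'.1 t ∈ U := by
    obtain ⟨y, δ, hδ, hγδ⟩ := hU U hUo hx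
    exact ⟨freeLoop δ, freelyHomotopic_iff.1 hγδ, fun t => hδ ⟨t, rfl⟩⟩
  refine hγ ?_
  obtain ⟨y, hy⟩ : ∃ y, Joined (freeLoop γ) (constLoop y) := by
    rcases smallLoopsContract_or x with ⟨U, hUo, hx, hl⟩ | rfl
    · obtain ⟨l', h1, h2⟩ := h U hUo hx
      obtain ⟨y, hy⟩ := hl l' h2
      exact ⟨y, h1.trans hy⟩
    · exact joined_const_of_forall_nhds h
  exact homotopic_refl_of_joined_const hy

end

end HawaiianPants

theorem mainTheorem2 : StronglyHomotopicallyHausdorff HawaiianPants.Space :=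
  ⟨inferInstance, HawaiianPants.stronglyHomotopicallyHausdorffAt⟩
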